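/- Let $0<a<1$, $\sigma^2=\frac{a}{1-a}$, and for $n\ge 0$ let $$H_n(x)=\frac{1}{K_n}\,e^{\frac{x^2}{2\sigma^2}}\,\frac{d^n}{dx^n}e^{-\frac{x^2}{\sigma^2}},\qquad K_n=\frac{\pi^{1/4}\,2^{n/2}\sqrt{n!}}{\sigma^{\,n-1/2}},$$ be the $L^2(\mathbb R)$-normalized Hermite functions. For every $a\in(0,1)$ and all constants $M,B\in\mathbb R$ there is a sequence $(L_n)$, depending only on $a$, $M$ and $B$, with $L_n=\mathcal O(n^{1/4})$ as $n\to\infty$, such that the following holds. Let $Y=X+Z$, where $Z\sim\mathcal N(0,1)$ is independent of $X$ and $X$ has a probability density $f$ with $f(x)\le M$ for all $x$. For every $y\in\mathbb R$ let $\psi(y)=\mathsf{med}(X\mid Y=y)$ be a median of the conditional law of $X$ given $Y=y$, i.e. of the law with density proportional to $f(x)e^{-(x-y)^2/2}$, and let $\psi^{-1}(x)=\inf\{y:\psi(y)\ge x\}$ be the inverse of the increasing function $\psi$. Let $\varepsilon\ge 0$ and assume that $$\int_{-\infty}^\infty \exp\!\left(\frac{1-a}{2}y^2-\min_{x\in[ay-\sqrt{2a\varepsilon},\,ay+\sqrt{2a\varepsilon}]}\frac{(x-y)^2}{2}\right)|ay-\psi(y)|\,dy\le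 B<\infty$$ and that there are real numbers $(b_i)_{i\in\mathbb Z}$ with $\sum_{i\in\mathbb Z} b_i\le\varepsilon$ such that $$\left|\psi^{-1}(x)-\frac{x}{a}\right|\le\Delta(x)\quad\text{for all }x\in\mathbb R,\qquad\text{where }\Delta(x)=b_i\text{ for }x\in[i,i+1).$$ Then, for every $n\ge 1$, $$|\langle f,H_n\rangle|=\left|\int_{-\infty}^\infty f(x)H_n(x)\,dx\right|\le L_n\,\varepsilon .$$ -/

import Mathlib

open MeasureTheory ProbabilityTheory Filter Asymptotics
open scoped ENNReal NNReal

/-- The conditional law of `X` given `Y = y` in the model `Y = X + Z`, with `Z ∼ 𝒩(0,1)` independent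
of `X` and `X ∼ μ`, given for every `y` by Bayes' formula: its density with respect to `μ` is
proportional to the likelihood `x ↦ exp (-(y - x)² / 2) / √(2π)`. -/
noncomputable def gaussianPosterior (μ : Measure ℝ) (y : ℝ) : Measure ℝ :=
  (∫⁻ x, gaussianPDF x 1 y ∂μ)⁻¹ • μ.withDensity (fun x => gaussianPDF x 1 y)

/-- `m` is a median of the probability measure `ν` on the line. -/
def IsMedian (ν : Measure ℝ) (m : ℝ) : Prop :=
  1 / 2 ≤ ν (Set.Iic m) ∧ 1 / 2 ≤ ν (Set.Ici m)

/-- The inverse `ψ⁻¹(x) = inf {y | x ≤ ψ y}` of an increasing function; it is the ordinary inverse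
where `ψ` is invertible, and it is constant across the jumps of `ψ`. -/
noncomputable def monoInverse (ψ : ℝ → ℝ) (x : ℝ) : ℝ :=
  sInf {y : ℝ | x ≤ ψ y}

/-- The squared width `σ² = a / (1 - a)` of the Hermite functions. -/
noncomputable def hermiteVar (a : ℝ) : ℝ := a / (1 - a)

/-- The normalization `K_n = π^(1/4) 2^(n/2) √(n!) / σ^(n - 1/2)`. -/
noncomputable def hermiteNorm (a : ℝ) (n : ℕ) : ℝ :=
  Real.pi ^ (1 / 4 : ℝ) * 2 ^ ((n : ℝ) / 2) * √(n.factorial : ℝ) /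
    √(hermiteVar a) ^ ((n : ℝ) - 1 / 2)

/-- The `L²`-normalized Hermite function
`H_n(x) = K_n⁻¹ exp (x² / (2σ²)) (d/dx)^n exp (-x² / σ²)`, with `σ² = a / (1 - a)`. -/
noncomputable def hermiteFun (a : ℝ) (n : ℕ) (x : ℝ) : ℝ :=
  1 / hermiteNorm a n * Real.exp (x ^ 2 / (2 * hermiteVar a)) *
    iteratedDeriv n (fun t : ℝ => Real.exp (-t ^ 2 / hermiteVar a)) x

/-- On the range of a strictly increasing `ψ`, `monoInverse ψ` is the ordinary inverse. -/
theorem monoInverse_apply {ψ : ℝ → ℝ} (hψ : StrictMono ψ) (y : ℝ) : monoInverse ψ (ψ y) = y := by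
  have : {z : ℝ | ψ y ≤ ψ z} = Set.Ici y := by
    ext z
    simp [hψ.le_iff_le]
  simp [monoInverse, this]

/-- The likelihood is jointly measurable. -/
theorem measurable_gaussianPDF_swap : Measurable (fun q : ℝ × ℝ => gaussianPDF q.2 1 q.1) := by
  refine Measurable.ennreal_ofReal ?_
  simp only [gaussianPDFReal_def]
  fun_prop

theorem measurable_gaussianPDF_left (y : ℝ) : Measurable (fun x : ℝ => gaussianPDF x 1 y) := by
  refine Measurable.ennreal_ofReal ?_
  simp only [gaussianPDFReal_def]
  fun_prop

theorem lintegral_gaussianPDF_ne_zero (μ : Measure ℝ) [IsProbabilityMeasure μ] (y : ℝ) :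
    ∫⁻ x, gaussianPDF x 1 y ∂μ ≠ 0 := by
  intro h
  rw [lintegral_eq_zero_iff (measurable_gaussianPDF_left y)] at h
  obtain ⟨x, hx⟩ := h.exists
  exact (gaussianPDF_pos x one_ne_zero y).ne' hx

theorem lintegral_gaussianPDF_ne_top (μ : Measure ℝ) [IsProbabilityMeasure μ] (y : ℝ) :
    ∫⁻ x, gaussianPDF x 1 y ∂μ ≠ ∞ := by
  have hb : ∀ x, gaussianPDF x 1 y ≤ ENNReal.ofReal (√(2 * Real.pi * (1 : ℝ≥0)))⁻¹ := by
    intro x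
    refine ENNReal.ofReal_le_ofReal ?_
    rw [gaussianPDFReal_def]
    refine mul_le_of_le_one_right (by positivity) (Real.exp_le_one_iff.2 ?_)
    rw [neg_div]
    exact neg_nonpos.2 (by positivity)
  refine ((lintegral_mono hb).trans_lt ?_).ne
  rw [lintegral_const, measure_univ, mul_one]
  exact ENNReal.ofReal_lt_top

theorem lintegral_map_add_prod {Ω : Type*} [MeasurableSpace Ω] (P : Measure Ω)
    [IsProbabilityMeasure P] (X Z : Ω → ℝ) (hX : Measurable X) (hZ : Measurable Z)
    (hXZ : IndepFun X Z P) (hZlaw : P.map Z = gaussianReal 0 1)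
    (h : ℝ × ℝ → ℝ≥0∞) (hh : Measurable h) :
    ∫⁻ q, h q ∂(P.map (fun ω => ((X + Z) ω, X ω))) =
      ∫⁻ y, ∫⁻ x, h (y, x) * gaussianPDF x 1 y ∂(P.map X) := by
  have : IsProbabilityMeasure (P.map X) := Measure.isProbabilityMeasure_map hX.aemeasurable
  have hpm := measurable_gaussianPDF_swap
  generalize hμ : P.map X = μ at *
  have hprod : P.map (fun ω => (X ω, Z ω)) = μ.prod (gaussianReal 0 1) := by
    rw [(indepFun_iff_map_prod_eq_prod_map_map hX.aemeasurable hZ.aemeasurable).1 hXZ, hZlaw, hμ]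
  have hT : Measurable (fun q : ℝ × ℝ => (q.1 + q.2, q.1)) := by fun_prop
  have : P.map (fun ω => ((X + Z) ω, X ω)) =
      (μ.prod (gaussianReal 0 1)).map (fun q : ℝ × ℝ => (q.1 + q.2, q.1)) := by
    rw [← hprod, Measure.map_map hT (hX.prodMk hZ)]
    rfl
  rw [this, lintegral_map hh hT, lintegral_prod _ (by fun_prop)]
  have hswap : ∫⁻ y, ∫⁻ x, h (y, x) * gaussianPDF x 1 y ∂μ =
      ∫⁻ x, (∫⁻ y, h (y, x) * gaussianPDF x 1 y) ∂μ :=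
    lintegral_lintegral_swap (hh.mul hpm).aemeasurable
  rw [hswap]
  refine lintegral_congr fun x => ?_
  have : gaussianReal x 1 = (gaussianReal 0 1).map (fun z => x + z) := by
    rw [gaussianReal_map_const_add, zero_add]
  have h3 : ∫⁻ y, h (y, x) ∂(gaussianReal x 1) = ∫⁻ z, h (x + z, x) ∂(gaussianReal 0 1) := by
    rw [this, lintegral_map (by fun_prop) (by fun_prop)]
  rw [← h3, gaussianReal_of_var_ne_zero _ one_ne_zero,
    lintegral_withDensity_eq_lintegral_mul _ (measurable_gaussianPDF x 1) (by fun_prop)]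
  refine lintegral_congr fun y => ?_
  simp [mul_comm]

theorem measurable_gaussianPosterior_density (μ : Measure ℝ) [IsProbabilityMeasure μ] :
    Measurable (Function.uncurry fun y x : ℝ =>
      (∫⁻ x, gaussianPDF x 1 y ∂μ)⁻¹ * gaussianPDF x 1 y) := by
  have h1 : Measurable fun y => ∫⁻ x, gaussianPDF x 1 y ∂μ :=
    measurable_gaussianPDF_swap.lintegral_prod_right'
  exact (h1.comp measurable_fst).inv.mul measurable_gaussianPDF_swap

/-- `gaussianPosterior` is a version of the regular conditional distribution of `X` given
`Y = X + Z`. -/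
theorem condDistrib_ae_eq_gaussianPosterior {Ω : Type*} [MeasurableSpace Ω] (P : Measure Ω)
    [IsProbabilityMeasure P] (X Z : Ω → ℝ) (hX : Measurable X) (hZ : Measurable Z)
    (hXZ : IndepFun X Z P) (hZlaw : P.map Z = gaussianReal 0 1) :
    ∀ᵐ y ∂(P.map (X + Z)), condDistrib X (X + Z) P y = gaussianPosterior (P.map X) y := by
  have : IsProbabilityMeasure (P.map X) := Measure.isProbabilityMeasure_map hX.aemeasurable
  set μ := P.map X
  let κ : Kernel ℝ ℝ :=
    Kernel.withDensity (Kernel.const ℝ μ) 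
      (fun y x => (∫⁻ x, gaussianPDF x 1 y ∂μ)⁻¹ * gaussianPDF x 1 y)
  have hκ : ∀ y, κ y = gaussianPosterior μ y := by
    intro y
    rw [Kernel.withDensity_apply _ (measurable_gaussianPosterior_density μ), Kernel.const_apply,
      gaussianPosterior]
    exact withDensity_smul _ (measurable_gaussianPDF_left y)
  have : IsMarkovKernel κ := ⟨fun y => ⟨by
    rw [hκ y, gaussianPosterior, Measure.smul_apply, withDensity_apply _ MeasurableSet.univ,
      Measure.restrict_univ, smul_eq_mul]
    exact ENNReal.inv_mul_cancel (lintegral_gaussianPDF_ne_zero μ y)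
      (lintegral_gaussianPDF_ne_top μ y)⟩⟩
  have hYm : Measurable (X + Z) := hX.add hZ
  have hpair : P.map (fun ω => ((X + Z) ω, X ω)) = P.map (X + Z) ⊗ₘ κ := by
    ext s hs
    have hY : ∀ h : ℝ → ℝ≥0∞, Measurable h →
        ∫⁻ y, h y ∂(P.map (X + Z)) = ∫⁻ y, h y * ∫⁻ x, gaussianPDF x 1 y ∂μ := by
      intro h hh
      have := lintegral_map_add_prod P X Z hX hZ hXZ hZlaw (fun q => h q.1) (by fun_prop)
      rw [lintegral_map (by fun_prop) (hYm.prodMk hX)] at this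
      rw [lintegral_map hh hYm, this]
      refine lintegral_congr fun y => ?_
      simp only
      rw [lintegral_const_mul _ (measurable_gaussianPDF_left y)]
    have h1 := lintegral_map_add_prod P X Z hX hZ hXZ hZlaw (s.indicator 1) (measurable_one.indicator hs)
    rw [lintegral_indicator_one hs] at h1
    rw [h1, Measure.compProd_apply hs, hY _ (Kernel.measurable_kernel_prodMk_left hs)]
    refine lintegral_congr fun y => ?_
    have hsy : MeasurableSet (Prod.mk y ⁻¹' s) := measurable_prodMk_left hs
    rw [hκ y, gaussianPosterior, Measure.smul_apply, withDensity_apply _ hsy, smul_eq_mul,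
      mul_comm, ← mul_assoc]
    rw [ENNReal.mul_inv_cancel (lintegral_gaussianPDF_ne_zero μ y)
      (lintegral_gaussianPDF_ne_top μ y), one_mul,
      ← lintegral_indicator hsy]
    refine lintegral_congr fun x => ?_
    by_cases hx : (y, x) ∈ s
    · simp [Set.indicator, hx]
    · simp [Set.indicator, hx]
  have := condDistrib_ae_eq_of_measure_eq_compProd_of_measurable (κ := κ) hYm hX hpair
  filter_upwards [this] with y hy
  rw [hy, hκ y]

/-!
The proof divides `f` by the Gaussian: put `F x = f x * exp (x² / (2σ²))` and
`k s = sign s * exp (-s² / (2a))`. Completing the square turns the statement that `ψ y` is a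
conditional median into an approximate convolution equation: `g y = ∫ F x k (x - a y) dx` vanishes
if `ψ y = a y`, and in general `|g y|` is at most twice the mass of `F x exp (-(x - a y)² / (2a))`
between `a y` and `ψ y` (`abs_oddTransform_le`).

*Inverting the kernel.* For `n ≥ 1` there is `h` with
`∫ k (x - a y) h y dy = exp (-x² / (2σ²)) H_n x`. Its Fourier transform is that of the `n`-th
derivative of a Gaussian divided by that of `k`, which is a multiple of Dawson's function `D`.
The differential equation `D' = a - a w D` gives `D w ≥ a w / (1 + a w²)` for `w ≥ 0`
(`le_gaussSine`), so `1 / D` costs one power of `w` at infinity and at zero, and Gamma function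
estimates give `sup |h| = O(n ^ (1/4))` (`exists_oddKernel_preimage_hermiteFun`).
Hence `⟨f, H_n⟩ = ∫ g h`, and it remains to bound the `L¹` norm of `g`.
Fubini's theorem does not apply directly, since `F` and `h` need not be integrable; the Riemann–Lebesgue
decay of `h` makes up for that (`integral_tiltedDensity_mul_eq`).

*The norm of `g`.* The weighted integral of `|a y - ψ y|` first gives `∫ |g| ≤ 2 M B`, provided that
`a ε ≤ 2`. Up to a constant factor, a primitive of `g` is the transform of `F` under the positive
kernel `∫_{|s|}^∞ |k|`, so this transform is bounded, and with it the mass of `F` on every unit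
interval (`lintegral_tiltedDensity_Icc_le`). Now the roles of `x` and `y` are exchanged: for fixed `x` the
points `y` such that `x` lies between `a y` and `ψ y` lie between `x / a` and `ψ⁻¹ x`, a set of
measure at most `b ⌊x⌋`, so that `∫ |g| ≤ 2 ∫ b ⌊x⌋ F x dx = O(∑ b_i) = O(ε)`
(`lintegral_oddTransform_le`).

If `a ε > 2` the window of half-width `√(2aε)` need not contain `ψ y`, but then
`|⟨f, H_n⟩| ≤ (∫ f² + ∫ H_n²) / 2 ≤ (M + 1) / 2` is enough.
-/

/-! ### The odd Gaussian kernel and its Fourier transform -/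

theorem integrable_pow_mul_exp_neg_mul_sq {b : ℝ} (hb : 0 < b) (n : ℕ) :
    Integrable fun x : ℝ => x ^ n * Real.exp (-b * x ^ 2) := by
  simpa using integrable_rpow_mul_exp_neg_mul_sq hb (s := n) (by
    have : (0 : ℝ) ≤ n := n.cast_nonneg
    linarith)

/-- The odd kernel `s ↦ sign s * exp (-s² / (2a))`. -/
noncomputable def oddKernel (a s : ℝ) : ℝ := Real.sign s * Real.exp (-s ^ 2 / (2 * a))

theorem measurable_real_sign : Measurable Real.sign := by
  have : Real.sign = fun r : ℝ => if r < 0 then -1 else if 0 < r then 1 else 0 := by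
    ext r
    simp [Real.sign]
  rw [this]
  exact Measurable.ite measurableSet_Iio measurable_const
    (Measurable.ite measurableSet_Ioi measurable_const measurable_const)

theorem abs_real_sign_le (s : ℝ) : |Real.sign s| ≤ 1 := by
  rcases Real.sign_apply_eq s with h | h | h <;> simp [h]

theorem measurable_oddKernel (a : ℝ) : Measurable (oddKernel a) := by
  unfold oddKernel
  exact measurable_real_sign.mul (by fun_prop)

theorem abs_oddKernel_le (a s : ℝ) : |oddKernel a s| ≤ Real.exp (-s ^ 2 / (2 * a)) := by
  rw [oddKernel, abs_mul, Real.abs_exp]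
  exact mul_le_of_le_one_left (Real.exp_pos _).le (abs_real_sign_le s)

theorem oddKernel_neg (a s : ℝ) : oddKernel a (-s) = -oddKernel a s := by
  simp [oddKernel, Real.sign_neg]

theorem integrable_exp_neg_sq_div {a : ℝ} (ha : 0 < a) :
    Integrable fun s : ℝ => Real.exp (-s ^ 2 / (2 * a)) := by
  have := integrable_exp_neg_mul_sq (b := 1 / (2 * a)) (by positivity)
  refine this.congr (Eventually.of_forall fun s => ?_)
  simp only
  congr 1
  field_simp

theorem integrable_oddKernel {a : ℝ} (ha : 0 < a) : Integrable (oddKernel a) :=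
  (integrable_exp_neg_sq_div ha).mono' (measurable_oddKernel a).aestronglyMeasurable
    (Eventually.of_forall fun s => abs_oddKernel_le a s)

/-- The sine transform of the Gaussian on the half line, a multiple of Dawson's function. -/
noncomputable def gaussSine (a w : ℝ) : ℝ :=
  ∫ u in Set.Ioi (0 : ℝ), Real.exp (-u ^ 2 / (2 * a)) * Real.sin (w * u)

theorem gaussSine_neg (a w : ℝ) : gaussSine a (-w) = -gaussSine a w := by
  simp [gaussSine, integral_neg]

theorem gaussSine_zero (a : ℝ) : gaussSine a 0 = 0 := by simp [gaussSine]

/-- Integration by parts turns the derivative of the sine transform into the transform itself. -/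
theorem hasDerivAt_gaussSine {a : ℝ} (ha : 0 < a) (w : ℝ) :
    HasDerivAt (gaussSine a) (a - a * w * gaussSine a w) w := by
  have hint1 : Integrable fun u : ℝ => |u| * Real.exp (-u ^ 2 / (2 * a)) := by
    have := (integrable_pow_mul_exp_neg_mul_sq (b := 1 / (2 * a)) (by positivity) 1).norm
    refine this.congr (Eventually.of_forall fun s => ?_)
    simp only [norm_mul, Real.norm_eq_abs, pow_one, Real.abs_exp]
    congr 2
    field_simp
  have hsin : Integrable fun u : ℝ => Real.exp (-u ^ 2 / (2 * a)) * Real.sin (w * u) := by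
    refine (integrable_exp_neg_sq_div ha).mono'
      (by fun_prop : Continuous _).aestronglyMeasurable (Eventually.of_forall fun u => ?_)
    rw [norm_mul, Real.norm_eq_abs, Real.abs_exp]
    exact mul_le_of_le_one_right (Real.exp_pos _).le (Real.abs_sin_le_one _)
  have hbound : ∀ w u : ℝ, ‖Real.exp (-u ^ 2 / (2 * a)) * (Real.cos (w * u) * u)‖
      ≤ |u| * Real.exp (-u ^ 2 / (2 * a)) := by
    intro w u
    rw [norm_mul, norm_mul, Real.norm_eq_abs, Real.abs_exp, mul_comm, Real.norm_eq_abs,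
      Real.norm_eq_abs]
    exact mul_le_mul_of_nonneg_right
      (mul_le_of_le_one_left (abs_nonneg _) (Real.abs_cos_le_one _)) (Real.exp_pos _).le
  have hcos : Integrable fun u : ℝ => Real.exp (-u ^ 2 / (2 * a)) * (Real.cos (w * u) * u) :=
    hint1.mono' (by fun_prop : Continuous _).aestronglyMeasurable
      (Eventually.of_forall fun u => hbound w u)
  have hder : HasDerivAt (gaussSine a)
      (∫ u in Set.Ioi (0 : ℝ), Real.exp (-u ^ 2 / (2 * a)) * (Real.cos (w * u) * u)) w := by
    refine (hasDerivAt_integral_of_dominated_loc_of_deriv_le (s := Set.univ)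
      (μ := volume.restrict (Set.Ioi (0 : ℝ)))
      (F := fun w u => Real.exp (-u ^ 2 / (2 * a)) * Real.sin (w * u))
      (F' := fun w u => Real.exp (-u ^ 2 / (2 * a)) * (Real.cos (w * u) * u))
      (bound := fun u => |u| * Real.exp (-u ^ 2 / (2 * a))) Filter.univ_mem ?_ hsin.integrableOn
      ?_ ?_ hint1.integrableOn ?_).2
    · exact Eventually.of_forall fun w => (by fun_prop : Continuous _).aestronglyMeasurable
    · exact (by fun_prop : Continuous _).aestronglyMeasurable
    · exact Eventually.of_forall fun u w _ => hbound w u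
    · refine Eventually.of_forall fun u w _ => ?_
      have : HasDerivAt (fun w : ℝ => w * u) u w := by simpa using (hasDerivAt_id w).mul_const u
      exact (this.sin).const_mul _
  refine hder.congr_deriv ?_
  -- the derivative of `exp (-u² / (2a)) cos (w u)` integrates to `-1` over the half line
  have hparts := integral_Ioi_of_hasDerivAt_of_tendsto (a := (0 : ℝ)) (m := 0)
    (f := fun u : ℝ => Real.exp (-u ^ 2 / (2 * a)) * Real.cos (w * u))
    (f' := fun u : ℝ => -(1 / a) * (Real.exp (-u ^ 2 / (2 * a)) * (Real.cos (w * u) * u))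
      - w * (Real.exp (-u ^ 2 / (2 * a)) * Real.sin (w * u)))
    (by fun_prop) (fun u _ => ?_)
    ((hcos.const_mul _).sub (hsin.const_mul _)).integrableOn ?_
  · rw [integral_sub (hcos.const_mul _).integrableOn (hsin.const_mul _).integrableOn,
      integral_const_mul, integral_const_mul, ← gaussSine] at hparts
    generalize (∫ u in Set.Ioi (0 : ℝ), Real.exp (-u ^ 2 / (2 * a)) * (Real.cos (w * u) * u)) = J
      at hparts ⊢
    simp only [ne_eq, OfNat.ofNat_ne_zero, not_false_eq_true, zero_pow, neg_zero, zero_div,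
      Real.exp_zero, mul_zero, Real.cos_zero, mul_one, zero_sub] at hparts
    field_simp at hparts
    linarith
  · have h2 : HasDerivAt (fun u : ℝ => w * u) w u := by simpa using (hasDerivAt_id u).const_mul w
    have h3 : HasDerivAt (fun u : ℝ => -u ^ 2 / (2 * a)) (-(1 / a) * u) u :=
      ((hasDerivAt_pow 2 u).fun_neg.div_const (2 * a)).congr_deriv (by push_cast; field_simp)
    exact (h3.exp.mul h2.cos).congr_deriv (by ring)
  · have hlim : Tendsto (fun u : ℝ => Real.exp (-u ^ 2 / (2 * a))) atTop (nhds 0) := by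
      refine Real.tendsto_exp_atBot.comp ?_
      have : Tendsto (fun u : ℝ => u ^ 2 / (2 * a)) atTop atTop :=
        (tendsto_pow_atTop two_ne_zero).atTop_div_const (by positivity)
      simpa [neg_div] using this
    refine squeeze_zero_norm (fun u => ?_) hlim
    rw [norm_mul, Real.norm_eq_abs, Real.abs_exp]
    exact mul_le_of_le_one_right (Real.exp_pos _).le (Real.abs_cos_le_one _)

/-- The lower bound comes from comparing both sides under the differential equation
`D' = a - a w D` satisfied by the sine transform `D`. -/
theorem le_gaussSine {a : ℝ} (ha : 0 < a) {w : ℝ} (hw : 0 ≤ w) :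
    a * w / (1 + a * w ^ 2) ≤ gaussSine a w := by
  have hd : ∀ t : ℝ, HasDerivAt
      (fun t => Real.exp (a * t ^ 2 / 2) * (gaussSine a t - a * t / (1 + a * t ^ 2)))
      (Real.exp (a * t ^ 2 / 2) * (2 * a ^ 2 * t ^ 2 / (1 + a * t ^ 2) ^ 2)) t := by
    intro t
    have hp : (1 + a * t ^ 2) ≠ 0 := by positivity
    have h1 : HasDerivAt (fun t : ℝ => a * t ^ 2 / 2) (a * t) t :=
      (((hasDerivAt_pow 2 t).const_mul a).div_const 2).congr_deriv (by push_cast; ring)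
    have h2 : HasDerivAt (fun t : ℝ => a * t) a t := by
      simpa using (hasDerivAt_id t).const_mul a
    have h3 : HasDerivAt (fun t : ℝ => 1 + a * t ^ 2) (2 * a * t) t :=
      (((hasDerivAt_pow 2 t).const_mul a).const_add 1).congr_deriv (by push_cast; ring)
    refine (h1.exp.mul ((hasDerivAt_gaussSine ha t).fun_sub (h2.fun_div h3 hp))).congr_deriv ?_
    field_simp
    ring
  have hmono := monotone_of_deriv_nonneg (fun t => (hd t).differentiableAt) (fun t => by
    rw [(hd t).deriv]; positivity)
  have h := hmono hw
  simp only [gaussSine_zero] at h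
  simp only [mul_zero, zero_div, sub_zero] at h
  have := nonneg_of_mul_nonneg_right h (Real.exp_pos _)
  linarith

theorem le_abs_gaussSine {a : ℝ} (ha : 0 < a) (w : ℝ) :
    a * |w| / (1 + a * w ^ 2) ≤ |gaussSine a w| := by
  rcases le_total 0 w with h | h
  · rw [abs_of_nonneg h]
    exact (le_gaussSine ha h).trans (le_abs_self _)
  · have := le_gaussSine ha (neg_nonneg.2 h)
    rw [gaussSine_neg, neg_sq] at this
    rw [abs_of_nonpos h]
    exact this.trans (neg_le_abs _)

theorem continuous_gaussSine {a : ℝ} (ha : 0 < a) : Continuous (gaussSine a) :=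
  continuous_iff_continuousAt.2 fun w => (hasDerivAt_gaussSine ha w).continuousAt

theorem integral_oddKernel_mul_cexp {a : ℝ} (ha : 0 < a) (w : ℝ) :
    ∫ s : ℝ, (oddKernel a s : ℂ) * Complex.exp (-(w * s : ℝ) * Complex.I)
      = -2 * Complex.I * gaussSine a w := by
  have hI : ∀ g : ℝ → ℝ, Continuous g → (∀ s, |g s| ≤ 1) →
      Integrable fun s => ((oddKernel a s * g s : ℝ) : ℂ) := by
    intro g hg hb
    refine Integrable.ofReal ?_
    refine (integrable_oddKernel ha).norm.mono'
      ((measurable_oddKernel a).mul hg.measurable).aestronglyMeasurable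
      (Eventually.of_forall fun s => ?_)
    exact (norm_mul _ _).trans_le (mul_le_of_le_one_right (norm_nonneg _) (hb s))
  have hcos := hI (fun s => Real.cos (w * s)) (by fun_prop) fun s => Real.abs_cos_le_one _
  have hsin := hI (fun s => Real.sin (w * s)) (by fun_prop) fun s => Real.abs_sin_le_one _
  have hsplit : ∀ s : ℝ, (oddKernel a s : ℂ) * Complex.exp (-(w * s : ℝ) * Complex.I)
      = ((oddKernel a s * Real.cos (w * s) : ℝ) : ℂ)
        - ((oddKernel a s * Real.sin (w * s) : ℝ) : ℂ) * Complex.I := by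
    intro s
    rw [Complex.exp_mul_I, Complex.cos_neg, Complex.sin_neg]
    push_cast
    ring
  simp_rw [hsplit]
  rw [integral_sub hcos (hsin.mul_const _), integral_mul_const, integral_complex_ofReal,
    integral_complex_ofReal]
  have h0 : ∫ s : ℝ, oddKernel a s * Real.cos (w * s) = 0 := by
    have h := integral_neg_eq_self (fun s : ℝ => oddKernel a s * Real.cos (w * s)) volume
    simp only [oddKernel_neg, mul_neg, Real.cos_neg, neg_mul, integral_neg] at h
    linarith
  have h1 : ∫ s : ℝ, oddKernel a s * Real.sin (w * s) = 2 * gaussSine a w := by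
    have h := integral_comp_abs (f := fun u : ℝ => Real.exp (-u ^ 2 / (2 * a)) * Real.sin (w * u))
    rw [gaussSine, ← h]
    congr 1
    ext s
    rw [oddKernel]
    rcases lt_trichotomy s 0 with hs | hs | hs
    · rw [Real.sign_of_neg hs, abs_of_neg hs]
      simp
    · simp [hs]
    · rw [Real.sign_of_pos hs, abs_of_pos hs]
      simp
  rw [h0, h1]
  push_cast
  ring

/-! ### A bounded solution of the convolution equation for Hermite functions -/

theorem hermiteVar_pos {a : ℝ} (ha0 : 0 < a) (ha1 : a < 1) : 0 < hermiteVar a :=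
  div_pos ha0 (by linarith)

theorem hermiteNorm_pos {a : ℝ} (ha0 : 0 < a) (ha1 : a < 1) (n : ℕ) : 0 < hermiteNorm a n := by
  have := hermiteVar_pos ha0 ha1
  unfold hermiteNorm
  positivity

/-- The Fourier density of the `n`-th derivative of `x ↦ exp (-x² / s)`. -/
noncomputable def gaussDerivFourier (s : ℝ) (n : ℕ) (w : ℝ) : ℂ :=
  (√(s / (4 * Real.pi)) : ℝ) * (Complex.I * w) ^ n * (Real.exp (-(s / 4) * w ^ 2) : ℝ)

theorem continuous_gaussDerivFourier (s : ℝ) (n : ℕ) : Continuous (gaussDerivFourier s n) := by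
  unfold gaussDerivFourier
  fun_prop

theorem norm_gaussDerivFourier (s : ℝ) (n : ℕ) (w : ℝ) :
    ‖gaussDerivFourier s n w‖ = √(s / (4 * Real.pi)) * (|w| ^ n * Real.exp (-(s / 4) * w ^ 2)) := by
  rw [gaussDerivFourier, norm_mul, norm_mul, norm_pow, norm_mul, Complex.norm_I, one_mul,
    Complex.norm_real, Complex.norm_real, Complex.norm_real, Real.norm_eq_abs, Real.norm_eq_abs,
    Real.norm_eq_abs, Real.abs_exp, abs_of_nonneg (Real.sqrt_nonneg _), mul_assoc]

theorem integrable_abs_pow_mul_exp {b : ℝ} (hb : 0 < b) (n : ℕ) :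
    Integrable fun w : ℝ => |w| ^ n * Real.exp (-b * w ^ 2) := by
  refine (integrable_pow_mul_exp_neg_mul_sq hb n).norm.congr (Eventually.of_forall fun w => ?_)
  simp only [norm_mul, norm_pow, Real.norm_eq_abs, Real.abs_exp]

theorem integrable_gaussDerivFourier {s : ℝ} (hs : 0 < s) (n : ℕ) :
    Integrable (gaussDerivFourier s n) := by
  refine ((integrable_abs_pow_mul_exp (b := s / 4) (by positivity) n).const_mul
    (√(s / (4 * Real.pi)))).mono' (continuous_gaussDerivFourier s n).aestronglyMeasurable
    (Eventually.of_forall fun w => (norm_gaussDerivFourier s n w).le)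

theorem norm_cexp_real_mul_I (x : ℝ) : ‖Complex.exp (x * Complex.I)‖ = 1 :=
  Complex.norm_exp_ofReal_mul_I x

theorem integral_gaussDerivFourier {s : ℝ} (hs : 0 < s) (n : ℕ) (x : ℝ) :
    ∫ w : ℝ, gaussDerivFourier s n w * Complex.exp ((w * x : ℝ) * Complex.I)
      = ((iteratedDeriv n (fun t : ℝ => Real.exp (-t ^ 2 / s)) x : ℝ) : ℂ) := by
  induction n generalizing x with
  | zero =>
    have h := fourierIntegral_gaussian (b := ((s / 4 : ℝ) : ℂ)) (by simpa using hs) x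
    simp only [gaussDerivFourier, pow_zero, mul_one, iteratedDeriv_zero]
    have h2 : ∀ w : ℝ, ((√(s / (4 * Real.pi)) : ℝ) : ℂ) * (Real.exp (-(s / 4) * w ^ 2) : ℝ) *
        Complex.exp ((w * x : ℝ) * Complex.I) = ((√(s / (4 * Real.pi)) : ℝ) : ℂ) *
        (Complex.exp (Complex.I * x * w) * Complex.exp (-((s / 4 : ℝ) : ℂ) * w ^ 2)) := by
      intro w
      rw [mul_assoc, mul_comm (Complex.exp (Complex.I * x * w))]
      push_cast
      congr 3
      ring
    simp_rw [h2]
    rw [integral_const_mul, h, ← mul_assoc]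
    have h3 : ((Real.pi : ℂ) / ((s / 4 : ℝ) : ℂ)) ^ (1 / 2 : ℂ)
        = ((√(Real.pi / (s / 4)) : ℝ) : ℂ) := by
      rw [Real.sqrt_eq_rpow, Complex.ofReal_cpow (by positivity)]
      push_cast
      rfl
    rw [h3, ← Complex.ofReal_mul, ← Real.sqrt_mul (by positivity)]
    have h4 : s / (4 * Real.pi) * (Real.pi / (s / 4)) = 1 := by
      field_simp
    rw [h4, Real.sqrt_one, Complex.ofReal_one, one_mul]
    push_cast
    congr 1
    field_simp
  | succ n ih =>
    have hd : HasDerivAt (fun x : ℝ => ∫ w : ℝ, gaussDerivFourier s n w *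
        Complex.exp ((w * x : ℝ) * Complex.I))
        (∫ w : ℝ, gaussDerivFourier s (n + 1) w * Complex.exp ((w * x : ℝ) * Complex.I)) x := by
      refine (hasDerivAt_integral_of_dominated_loc_of_deriv_le (s := Set.univ)
        (F := fun (x : ℝ) (w : ℝ) => gaussDerivFourier s n w *
          Complex.exp ((w * x : ℝ) * Complex.I))
        (F' := fun (x : ℝ) (w : ℝ) => gaussDerivFourier s (n + 1) w *
          Complex.exp ((w * x : ℝ) * Complex.I))
        (bound := fun w => ‖gaussDerivFourier s (n + 1) w‖) Filter.univ_mem ?_ ?_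
        ?_ ?_ (integrable_gaussDerivFourier hs _).norm ?_).2
      · refine Eventually.of_forall fun x => Continuous.aestronglyMeasurable ?_
        have := continuous_gaussDerivFourier s n
        fun_prop
      · refine (integrable_gaussDerivFourier hs n).norm.mono' ?_ (Eventually.of_forall fun w => ?_)
        · refine Continuous.aestronglyMeasurable ?_
          have := continuous_gaussDerivFourier s n
          fun_prop
        · rw [norm_mul, norm_cexp_real_mul_I, mul_one]
      · refine Continuous.aestronglyMeasurable ?_
        have := continuous_gaussDerivFourier s (n + 1)
        fun_prop
      · refine Eventually.of_forall fun w x _ => ?_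
        rw [norm_mul, norm_cexp_real_mul_I, mul_one]
      · refine Eventually.of_forall fun w x _ => ?_
        have h1 : HasDerivAt (fun x : ℝ => ((w * x : ℝ) : ℂ) * Complex.I) (w * Complex.I) x := by
          have : HasDerivAt (fun x : ℝ => w * x) w x := by
            simpa using (hasDerivAt_id x).const_mul w
          exact this.ofReal_comp.mul_const _
        refine (h1.cexp.const_mul (gaussDerivFourier s n w)).congr_deriv ?_
        simp only [gaussDerivFourier, pow_succ]
        ring
    have hd2 : HasDerivAt (fun x : ℝ => ∫ w : ℝ, gaussDerivFourier s n w *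
        Complex.exp ((w * x : ℝ) * Complex.I))
        ((iteratedDeriv (n + 1) (fun t : ℝ => Real.exp (-t ^ 2 / s)) x : ℝ) : ℂ) x := by
      simp_rw [ih]
      have hc : ContDiff ℝ (n + 1 : ℕ) (fun t : ℝ => Real.exp (-t ^ 2 / s)) := by fun_prop
      have : HasDerivAt (iteratedDeriv n (fun t : ℝ => Real.exp (-t ^ 2 / s)))
          (iteratedDeriv (n + 1) (fun t : ℝ => Real.exp (-t ^ 2 / s)) x) x := by
        rw [iteratedDeriv_succ]
        exact ((hc.differentiable_iteratedDeriv n (by exact_mod_cast n.lt_succ_self)) x).hasDerivAt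
      exact this.ofReal_comp
    exact hd.unique hd2

/-- The Fourier density of the solution `h` of `∫ k (x - a y) h y dy = (dⁿ/dxⁿ) exp (-x² / σ²)`,
where `k` is the odd kernel: the density of the right-hand side divided by the Fourier transform
of `k`. At `w = 0` the quotient is `0` by convention. -/
noncomputable def solutionFourier (a : ℝ) (n : ℕ) (w : ℝ) : ℂ :=
  gaussDerivFourier (hermiteVar a) n w * (a / (-2 * Complex.I * gaussSine a w))

theorem measurable_solutionFourier {a : ℝ} (ha : 0 < a) (n : ℕ) :
    Measurable (solutionFourier a n) := by
  have h1 := (continuous_gaussDerivFourier (hermiteVar a) n).measurable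
  have h2 := (continuous_gaussSine ha).measurable
  unfold solutionFourier
  fun_prop

theorem norm_solutionFourier_le {a : ℝ} (ha0 : 0 < a) (n : ℕ) (w : ℝ) :
    ‖solutionFourier a (n + 1) w‖ ≤ √(hermiteVar a / (4 * Real.pi)) / 2 *
      (|w| ^ n * Real.exp (-(hermiteVar a / 4) * w ^ 2)
        + a * (|w| ^ (n + 2) * Real.exp (-(hermiteVar a / 4) * w ^ 2))) := by
  rcases eq_or_ne w 0 with rfl | hw
  · rw [solutionFourier, gaussSine_zero]
    simp only [Complex.ofReal_zero, mul_zero, div_zero, norm_zero]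
    positivity
  have hD := le_abs_gaussSine ha0 w
  have hw' : 0 < |w| := abs_pos.2 hw
  have hpos : 0 < a * |w| / (1 + a * w ^ 2) := by positivity
  rw [solutionFourier, norm_mul, norm_gaussDerivFourier, norm_div, norm_mul, norm_mul, norm_neg,
    Complex.norm_I, Complex.norm_real, Complex.norm_real, Real.norm_eq_abs, Real.norm_eq_abs,
    abs_of_pos ha0, Complex.norm_ofNat]
  have h1 : a / (2 * 1 * |gaussSine a w|) ≤ a / (2 * 1 * (a * |w| / (1 + a * w ^ 2))) := by
    gcongr
  refine (mul_le_mul_of_nonneg_left h1 (by positivity)).trans_eq ?_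
  rw [← sq_abs w]
  field_simp
  ring

theorem integral_abs_pow_mul_exp {b : ℝ} (hb : 0 < b) (n : ℕ) :
    ∫ w : ℝ, |w| ^ n * Real.exp (-b * w ^ 2)
      = b ^ (-((n : ℝ) + 1) / 2) * Real.Gamma (((n : ℝ) + 1) / 2) := by
  have h := integral_comp_abs (f := fun w : ℝ => w ^ n * Real.exp (-b * w ^ 2))
  simp only [sq_abs] at h
  have h2 := integral_rpow_mul_exp_neg_mul_rpow (p := 2) (q := n) (b := b) two_pos (by
    have : (0 : ℝ) ≤ n := n.cast_nonneg
    linarith) hb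
  norm_cast at h2
  rw [h, h2]
  push_cast
  ring

/-- `Γ(n/2 + 1)² ≤ √π √((n+1)/2) n! / 2ⁿ`, from Legendre's duplication formula and the
log-convexity of `Γ`. -/
theorem Gamma_half_sq_le (n : ℕ) : 2 ^ n * Real.Gamma ((n : ℝ) / 2 + 1) ^ 2
    ≤ √Real.pi * √(((n : ℝ) + 1) / 2) * n.factorial := by
  set s : ℝ := ((n : ℝ) + 1) / 2 with hs
  have hs0 : 0 < s := by positivity
  have e1 : (n : ℝ) / 2 + 1 = s + 1 / 2 := by rw [hs]; ring
  have hdup := Real.Gamma_mul_Gamma_add_half s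
  have e2 : Real.Gamma (2 * s) = n.factorial := by
    rw [show 2 * s = (n : ℝ) + 1 by rw [hs]; ring, Real.Gamma_nat_eq_factorial]
  have e3 : (2 : ℝ) ^ (1 - 2 * s) = (2 ^ n)⁻¹ := by
    rw [show 1 - 2 * s = -(n : ℝ) by rw [hs]; ring, Real.rpow_neg two_pos.le, Real.rpow_natCast]
  rw [e2, e3] at hdup
  have hconv := Real.Gamma_mul_add_mul_le_rpow_Gamma_mul_rpow_Gamma (s := s) (t := s + 1)
    (a := 1 / 2) (b := 1 / 2) hs0 (by positivity) (by norm_num) (by norm_num) (by norm_num)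
  have hG := Real.Gamma_pos_of_pos hs0
  have e4 : Real.Gamma s ^ (1 / 2 : ℝ) * Real.Gamma (s + 1) ^ (1 / 2 : ℝ) = √s * Real.Gamma s := by
    rw [Real.Gamma_add_one hs0.ne', ← Real.sqrt_eq_rpow, ← Real.sqrt_eq_rpow,
      Real.sqrt_mul hs0.le, mul_left_comm, Real.mul_self_sqrt hG.le]
  rw [e4, show 1 / 2 * s + 1 / 2 * (s + 1) = s + 1 / 2 by ring] at hconv
  have hG2 := Real.Gamma_pos_of_pos (show 0 < s + 1 / 2 by positivity)
  rw [e1]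
  calc 2 ^ n * Real.Gamma (s + 1 / 2) ^ 2
      = 2 ^ n * (Real.Gamma (s + 1 / 2) * Real.Gamma (s + 1 / 2)) := by ring
    _ ≤ 2 ^ n * (√s * Real.Gamma s * Real.Gamma (s + 1 / 2)) := by gcongr
    _ = 2 ^ n * (√s * (Real.Gamma s * Real.Gamma (s + 1 / 2))) := by ring
    _ = √Real.pi * √s * n.factorial := by
      rw [hdup]
      field_simp

theorem integrable_solutionFourier {a : ℝ} (ha0 : 0 < a) (ha1 : a < 1) (n : ℕ) :
    Integrable (solutionFourier a (n + 1)) := by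
  have hs := hermiteVar_pos ha0 ha1
  exact (((integrable_abs_pow_mul_exp (b := hermiteVar a / 4) (by positivity) n).add
    ((integrable_abs_pow_mul_exp (b := hermiteVar a / 4) (by positivity) (n + 2)).const_mul a)
    ).const_mul _).mono' (measurable_solutionFourier ha0 _).aestronglyMeasurable
    (Eventually.of_forall fun w => norm_solutionFourier_le ha0 n w)

/-- The solution `h` of `∫ k (x - a y) h y dy = (dⁿ/dxⁿ) exp (-x² / σ²)`. -/
noncomputable def solution (a : ℝ) (n : ℕ) (y : ℝ) : ℂ :=
  ∫ w : ℝ, solutionFourier a n w * Complex.exp ((w * (a * y) : ℝ) * Complex.I)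

theorem norm_solution_le_integral (a : ℝ) (n : ℕ) (y : ℝ) :
    ‖solution a n y‖ ≤ ∫ w : ℝ, ‖solutionFourier a n w‖ := by
  refine (norm_integral_le_integral_norm _).trans_eq ?_
  simp only [norm_mul, norm_cexp_real_mul_I, mul_one]

theorem solution_eq_fourier (a : ℝ) (n : ℕ) :
    solution a n = fun y => FourierTransform.fourier (solutionFourier a n)
      (-(a / (2 * Real.pi)) * y) := by
  ext y
  rw [Real.fourier_real_eq_integral_exp_smul, solution]
  congr 1
  ext w
  rw [smul_eq_mul, mul_comm]
  congr 3
  push_cast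
  field_simp

theorem continuous_solution {a : ℝ} (ha0 : 0 < a) (ha1 : a < 1) (n : ℕ) :
    Continuous (solution a (n + 1)) := by
  refine continuous_of_dominated (F := fun (y : ℝ) (w : ℝ) => solutionFourier a (n + 1) w *
    Complex.exp ((w * (a * y) : ℝ) * Complex.I)) (bound := fun w => ‖solutionFourier a (n + 1) w‖)
    (fun y => ?_) (fun y => Eventually.of_forall fun w => ?_)
    (integrable_solutionFourier ha0 ha1 n).norm (Eventually.of_forall fun w => ?_)
  · have := measurable_solutionFourier ha0 (n + 1)
    exact (by fun_prop : Measurable _).aestronglyMeasurable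
  · rw [norm_mul, norm_cexp_real_mul_I, mul_one]
  · fun_prop

/-- The Riemann–Lebesgue lemma for the solution. -/
theorem tendsto_solution {a : ℝ} (ha0 : 0 < a) (n : ℕ) :
    Tendsto (solution a n) (cocompact ℝ) (nhds 0) := by
  rw [solution_eq_fourier]
  refine (Real.zero_at_infty_fourier (solutionFourier a n)).comp ?_
  have : -(a / (2 * Real.pi)) ≠ 0 := neg_ne_zero.2 (by positivity)
  exact (Homeomorph.mulLeft₀ _ this).isClosedEmbedding.tendsto_cocompact

theorem integral_oddKernel_comp_mul_cexp {a : ℝ} (ha : 0 < a) (x w : ℝ) :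
    ∫ y : ℝ, (oddKernel a (x - a * y) : ℂ) * Complex.exp ((w * (a * y) : ℝ) * Complex.I)
      = Complex.exp ((w * x : ℝ) * Complex.I) * (-2 * Complex.I * gaussSine a w / a) := by
  have h1 := Measure.integral_comp_mul_left
    (fun z : ℝ => (oddKernel a (x - z) : ℂ) * Complex.exp ((w * z : ℝ) * Complex.I)) a
  rw [h1]
  have h2 := integral_sub_left_eq_self
    (fun z : ℝ => (oddKernel a z : ℂ) * Complex.exp ((w * (x - z) : ℝ) * Complex.I)) volume x
  simp only [sub_sub_cancel] at h2
  rw [h2]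
  have h3 : ∀ z : ℝ, (oddKernel a z : ℂ) * Complex.exp ((w * (x - z) : ℝ) * Complex.I)
      = Complex.exp ((w * x : ℝ) * Complex.I) *
        ((oddKernel a z : ℂ) * Complex.exp (-(w * z : ℝ) * Complex.I)) := by
    intro z
    rw [mul_left_comm, ← Complex.exp_add]
    congr 2
    push_cast
    ring
  simp_rw [h3]
  rw [integral_const_mul, integral_oddKernel_mul_cexp ha, abs_of_pos (by positivity),
    Complex.real_smul]
  push_cast
  field_simp

theorem integral_oddKernel_mul_solution {a : ℝ} (ha0 : 0 < a) (ha1 : a < 1) (n : ℕ) (x : ℝ) :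
    ∫ y : ℝ, (oddKernel a (x - a * y) : ℂ) * solution a (n + 1) y
      = ((iteratedDeriv (n + 1) (fun t : ℝ => Real.exp (-t ^ 2 / hermiteVar a)) x : ℝ) : ℂ) := by
  rw [← integral_gaussDerivFourier (hermiteVar_pos ha0 ha1)]
  have hk : Integrable fun y : ℝ => (oddKernel a (x - a * y) : ℂ) := by
    refine Integrable.ofReal ?_
    exact ((integrable_oddKernel ha0).comp_sub_left x).comp_mul_left' ha0.ne'
  have hprod : Integrable (fun p : ℝ × ℝ => (oddKernel a (x - a * p.1) : ℂ) *
      (solutionFourier a (n + 1) p.2 * Complex.exp ((p.2 * (a * p.1) : ℝ) * Complex.I)))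
      (volume.prod volume) := by
    have h1 := hk.mul_prod (integrable_solutionFourier ha0 ha1 n)
    have hc : Continuous fun p : ℝ × ℝ => Complex.exp ((p.2 * (a * p.1) : ℝ) * Complex.I) := by
      fun_prop
    refine (Integrable.mul_bdd (c := 1) h1 hc.aestronglyMeasurable
      (Eventually.of_forall fun p => (norm_cexp_real_mul_I _).le)).congr
      (Eventually.of_forall fun p => ?_)
    simp only [mul_assoc]
  simp_rw [solution, ← integral_const_mul]
  rw [integral_integral_swap hprod]
  refine integral_congr_ae ?_
  filter_upwards [Measure.ae_ne volume (0 : ℝ)] with w hw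
  have hD : (gaussSine a w : ℂ) ≠ 0 := by
    have h := le_abs_gaussSine ha0 w
    have h0 : 0 < a * |w| / (1 + a * w ^ 2) := by
      have := abs_pos.2 hw
      positivity
    exact_mod_cast abs_pos.1 (h0.trans_le h)
  have ha : (a : ℂ) ≠ 0 := by exact_mod_cast ha0.ne'
  have : ∀ y : ℝ, (oddKernel a (x - a * y) : ℂ) * (solutionFourier a (n + 1) w *
      Complex.exp ((w * (a * y) : ℝ) * Complex.I)) = solutionFourier a (n + 1) w *
      ((oddKernel a (x - a * y) : ℂ) * Complex.exp ((w * (a * y) : ℝ) * Complex.I)) :=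
    fun y => mul_left_comm _ _ _
  simp_rw [this]
  rw [integral_const_mul, integral_oddKernel_comp_mul_cexp ha0, solutionFourier]
  have hI := Complex.I_ne_zero
  field_simp

/-! ### The Hermite functions have unit norm -/

open Polynomial in
/-- The polynomial `p` with `(dⁿ/dxⁿ) exp (-x² / s) = p x * exp (-x² / s)`. -/
noncomputable def gaussDerivPoly (s : ℝ) : ℕ → ℝ[X]
  | 0 => 1
  | n + 1 => derivative (gaussDerivPoly s n) - C (2 / s) * X * gaussDerivPoly s n

theorem hasDerivAt_gaussDerivPoly_mul (s : ℝ) (n : ℕ) (x : ℝ) :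
    HasDerivAt (fun x => (gaussDerivPoly s n).eval x * Real.exp (-x ^ 2 / s))
      ((gaussDerivPoly s (n + 1)).eval x * Real.exp (-x ^ 2 / s)) x := by
  have h1 : HasDerivAt (fun x : ℝ => -x ^ 2 / s) (-(2 / s) * x) x :=
    ((hasDerivAt_pow 2 x).fun_neg.div_const s).congr_deriv (by push_cast; ring)
  refine (((gaussDerivPoly s n).hasDerivAt x).mul h1.exp).congr_deriv ?_
  simp only [gaussDerivPoly, Polynomial.eval_sub, Polynomial.eval_mul, Polynomial.eval_C,
    Polynomial.eval_X]
  ring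

theorem iteratedDeriv_exp_neg_sq_div (s : ℝ) (n : ℕ) :
    iteratedDeriv n (fun t : ℝ => Real.exp (-t ^ 2 / s))
      = fun x => (gaussDerivPoly s n).eval x * Real.exp (-x ^ 2 / s) := by
  induction n with
  | zero => simp [gaussDerivPoly]
  | succ n ih =>
    rw [iteratedDeriv_succ, ih]
    ext x
    exact (hasDerivAt_gaussDerivPoly_mul s n x).deriv

open Polynomial in
theorem derivative_gaussDerivPoly (s : ℝ) (n : ℕ) :
    derivative (gaussDerivPoly s (n + 1)) = C (-(2 * (n + 1) / s)) * gaussDerivPoly s n := by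
  induction n with
  | zero => simp [gaussDerivPoly]
  | succ n ih =>
    have h : gaussDerivPoly s (n + 2)
        = derivative (gaussDerivPoly s (n + 1)) - C (2 / s) * X * gaussDerivPoly s (n + 1) := rfl
    have h' : gaussDerivPoly s (n + 1)
        = derivative (gaussDerivPoly s n) - C (2 / s) * X * gaussDerivPoly s n := rfl
    have e : C (-(2 * ((n + 1 : ℕ) + 1) / s)) = C (-(2 * (n + 1) / s)) - C (2 / s) := by
      rw [← C_sub]
      congr 1
      push_cast
      ring
    rw [h, derivative_sub, derivative_mul, derivative_mul, derivative_C, derivative_X, ih,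
      derivative_mul, derivative_C, e]
    linear_combination -C (-(2 * ((n : ℝ) + 1) / s)) * h'

theorem integrable_eval_mul_exp {s : ℝ} (hs : 0 < s) (p : Polynomial ℝ) :
    Integrable fun x : ℝ => p.eval x * Real.exp (-x ^ 2 / s) := by
  induction p using Polynomial.induction_on' with
  | add p q hp hq => simpa [add_mul] using! hp.add hq
  | monomial n c =>
    refine ((integrable_pow_mul_exp_neg_mul_sq (b := 1 / s) (by positivity) n).const_mul c).congr
      (Eventually.of_forall fun x => ?_)
    simp only [Polynomial.eval_monomial, mul_assoc]
    congr 3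
    ring

theorem integral_gaussDerivPoly_sq {s : ℝ} (hs : 0 < s) (n : ℕ) :
    ∫ x : ℝ, (gaussDerivPoly s n).eval x ^ 2 * Real.exp (-x ^ 2 / s)
      = (2 / s) ^ n * n.factorial * √(Real.pi * s) := by
  induction n with
  | zero =>
    have h := integral_gaussian (1 / s)
    rw [div_div_eq_mul_div, div_one] at h
    simp only [gaussDerivPoly, Polynomial.eval_one, one_pow, one_mul, pow_zero,
      Nat.factorial_zero, Nat.cast_one]
    rw [← h]
    congr 1
    ext x
    congr 1
    ring
  | succ n ih =>
    have hd : ∀ x, (Polynomial.derivative (gaussDerivPoly s (n + 1))).eval x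
        = -(2 * (n + 1) / s) * (gaussDerivPoly s n).eval x := by
      intro x
      rw [derivative_gaussDerivPoly, Polynomial.eval_mul, Polynomial.eval_C]
    have hI : ∀ p q : Polynomial ℝ, Integrable ((fun x => p.eval x) *
        fun x => q.eval x * Real.exp (-x ^ 2 / s)) := by
      intro p q
      refine (integrable_eval_mul_exp hs (p * q)).congr (Eventually.of_forall fun x => ?_)
      simp only [Pi.mul_apply, Polynomial.eval_mul]
      ring
    have h := integral_mul_deriv_eq_deriv_mul_of_integrable
      (u := fun x => (gaussDerivPoly s (n + 1)).eval x)
      (u' := fun x => (Polynomial.derivative (gaussDerivPoly s (n + 1))).eval x)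
      (fun x _ => (gaussDerivPoly s (n + 1)).hasDerivAt x)
      (fun x _ => hasDerivAt_gaussDerivPoly_mul s n x) (hI _ _) (hI _ _) (hI _ _)
    simp only [hd] at h
    have e1 : ∀ x : ℝ, (gaussDerivPoly s (n + 1)).eval x ^ 2 * Real.exp (-x ^ 2 / s)
        = (gaussDerivPoly s (n + 1)).eval x *
          ((gaussDerivPoly s (n + 1)).eval x * Real.exp (-x ^ 2 / s)) := fun x => by ring
    have e2 : ∀ x : ℝ, -(2 * (n + 1) / s) * (gaussDerivPoly s n).eval x *
        ((gaussDerivPoly s n).eval x * Real.exp (-x ^ 2 / s)) = -(2 * (n + 1) / s) *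
        ((gaussDerivPoly s n).eval x ^ 2 * Real.exp (-x ^ 2 / s)) := fun x => by ring
    simp_rw [e1]
    rw [h]
    simp_rw [e2]
    rw [integral_const_mul, ih, Nat.factorial_succ]
    push_cast
    ring

theorem hermiteNorm_sq {a : ℝ} (ha0 : 0 < a) (ha1 : a < 1) (n : ℕ) :
    hermiteNorm a n ^ 2
      = (2 / hermiteVar a) ^ n * n.factorial * √(Real.pi * hermiteVar a) := by
  have hs := hermiteVar_pos ha0 ha1
  have hr : 0 < √(hermiteVar a) := Real.sqrt_pos.2 hs
  rw [hermiteNorm, div_pow, mul_pow, mul_pow, Real.sq_sqrt (by positivity), ← Real.rpow_natCast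
    (Real.pi ^ (1 / 4 : ℝ)), ← Real.rpow_natCast ((2 : ℝ) ^ ((n : ℝ) / 2)), ← Real.rpow_natCast
    (√(hermiteVar a) ^ ((n : ℝ) - 1 / 2)), ← Real.rpow_mul Real.pi_pos.le, ← Real.rpow_mul two_pos.le,
    ← Real.rpow_mul hr.le]
  have e1 : (1 / 4 : ℝ) * (2 : ℕ) = 1 / 2 := by norm_num
  have e2 : (n : ℝ) / 2 * (2 : ℕ) = n := by push_cast; ring
  have e3 : ((n : ℝ) - 1 / 2) * (2 : ℕ) = (2 : ℕ) * (n : ℝ) - 1 := by push_cast; ring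
  rw [e1, e2, e3, ← Real.sqrt_eq_rpow, Real.rpow_natCast, Real.rpow_sub hr, Real.rpow_one,
    Real.rpow_mul hr.le, Real.rpow_natCast _ 2, Real.sq_sqrt hs.le, Real.rpow_natCast,
    Real.sqrt_mul Real.pi_pos.le, div_pow]
  field_simp

theorem hermiteFun_sq (a : ℝ) (n : ℕ) (x : ℝ) :
    hermiteFun a n x ^ 2 = (hermiteNorm a n ^ 2)⁻¹ *
      ((gaussDerivPoly (hermiteVar a) n).eval x ^ 2 * Real.exp (-x ^ 2 / hermiteVar a)) := by
  rw [hermiteFun, iteratedDeriv_exp_neg_sq_div]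
  simp only
  have : Real.exp (x ^ 2 / (2 * hermiteVar a)) ^ 2 * Real.exp (-x ^ 2 / hermiteVar a) = 1 := by
    rw [← Real.exp_nat_mul, ← Real.exp_add, Real.exp_eq_one_iff]
    rcases eq_or_ne (hermiteVar a) 0 with h | h
    · simp [h]
    · field_simp
      push_cast
      ring
  rw [mul_pow, mul_pow, mul_pow, sq (Real.exp (-x ^ 2 / hermiteVar a)), one_div, inv_pow]
  linear_combination (hermiteNorm a n ^ 2)⁻¹ *
    (gaussDerivPoly (hermiteVar a) n).eval x ^ 2 * Real.exp (-x ^ 2 / hermiteVar a) * this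

theorem integrable_hermiteFun_sq {a : ℝ} (ha0 : 0 < a) (ha1 : a < 1) (n : ℕ) :
    Integrable fun x => hermiteFun a n x ^ 2 := by
  simp_rw [hermiteFun_sq]
  refine Integrable.const_mul ?_ _
  refine (integrable_eval_mul_exp (hermiteVar_pos ha0 ha1)
    (gaussDerivPoly (hermiteVar a) n ^ 2)).congr (Eventually.of_forall fun x => ?_)
  simp only [Polynomial.eval_pow]

theorem integral_hermiteFun_sq {a : ℝ} (ha0 : 0 < a) (ha1 : a < 1) (n : ℕ) :
    ∫ x, hermiteFun a n x ^ 2 = 1 := by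
  simp_rw [hermiteFun_sq]
  rw [integral_const_mul, integral_gaussDerivPoly_sq (hermiteVar_pos ha0 ha1),
    ← hermiteNorm_sq ha0 ha1]
  exact inv_mul_cancel₀ (pow_pos (hermiteNorm_pos ha0 ha1 n) 2).ne'

theorem continuous_hermiteFun (a : ℝ) (n : ℕ) : Continuous (hermiteFun a n) := by
  unfold hermiteFun
  rw [iteratedDeriv_exp_neg_sq_div]
  fun_prop

/-! ### Growth of the solution of the convolution equation -/

theorem rpow_mul_Gamma_le_hermiteNorm {a : ℝ} (ha0 : 0 < a) (ha1 : a < 1) {n : ℕ} (hn : 1 ≤ n) :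
    (hermiteVar a / 4) ^ (-(n : ℝ) / 2) * Real.Gamma ((n : ℝ) / 2 + 1)
      ≤ hermiteNorm a n * (hermiteVar a ^ (-(1 / 4) : ℝ) * (n : ℝ) ^ (1 / 4 : ℝ)) := by
  have hs := hermiteVar_pos ha0 ha1
  have hK := hermiteNorm_pos ha0 ha1 n
  refine le_of_sq_le_sq ?_ (by positivity)
  rw [mul_pow, mul_pow, mul_pow, hermiteNorm_sq ha0 ha1]
  have hquart : ∀ t : ℝ, 0 ≤ t → (t ^ (1 / 4 : ℝ)) ^ 2 = √t := by
    intro t ht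
    rw [← Real.rpow_natCast, ← Real.rpow_mul ht, Real.sqrt_eq_rpow]
    norm_num
  have e1 : ((hermiteVar a / 4) ^ (-(n : ℝ) / 2)) ^ 2 = (2 / hermiteVar a) ^ n * 2 ^ n := by
    rw [← Real.rpow_natCast, ← Real.rpow_mul (by positivity),
      show -(n : ℝ) / 2 * (2 : ℕ) = -n by push_cast; ring, Real.rpow_neg (by positivity),
      Real.rpow_natCast, ← inv_pow, ← mul_pow]
    congr 1
    field_simp
    norm_num
  have hn1 : (1 : ℝ) ≤ n := by exact_mod_cast hn
  rw [e1, hquart _ n.cast_nonneg, Real.rpow_neg hs.le, inv_pow, hquart _ hs.le, mul_assoc]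
  refine (mul_le_mul_of_nonneg_left (Gamma_half_sq_le n) (by positivity)).trans ?_
  rw [Real.sqrt_mul Real.pi_pos.le]
  have hle : √(((n : ℝ) + 1) / 2) ≤ √n := Real.sqrt_le_sqrt (by linarith)
  have hr : 0 < √(hermiteVar a) := Real.sqrt_pos.2 hs
  calc (2 / hermiteVar a) ^ n * (√Real.pi * √(((n : ℝ) + 1) / 2) * n.factorial)
      ≤ (2 / hermiteVar a) ^ n * (√Real.pi * √n * n.factorial) := by gcongr
    _ = _ := by field_simp

theorem exists_integral_norm_solutionFourier_le {a : ℝ} (ha0 : 0 < a) (ha1 : a < 1) :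
    ∃ C : ℝ, 0 ≤ C ∧ ∀ n : ℕ, 1 ≤ n → ∫ w : ℝ, ‖solutionFourier a n w‖
      ≤ C * (n : ℝ) ^ (1 / 4 : ℝ) * hermiteNorm a n := by
  have hs := hermiteVar_pos ha0 ha1
  set b := hermiteVar a / 4 with hb
  have hb0 : 0 < b := by positivity
  set c := √(hermiteVar a / (4 * Real.pi)) / 2 with hc
  have hc0 : 0 ≤ c := by positivity
  refine ⟨c * (2 + a / b) * hermiteVar a ^ (-(1 / 4) : ℝ), by positivity, fun n hn => ?_⟩
  obtain ⟨m, rfl⟩ : ∃ m, n = m + 1 := ⟨n - 1, by omega⟩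
  have hI1 := integrable_abs_pow_mul_exp hb0 m
  have hI2 := (integrable_abs_pow_mul_exp hb0 (m + 2)).const_mul a
  have h1 : ∫ w : ℝ, ‖solutionFourier a (m + 1) w‖ ≤ ∫ w : ℝ, c * (|w| ^ m * Real.exp (-b * w ^ 2)
        + a * (|w| ^ (m + 2) * Real.exp (-b * w ^ 2))) :=
    integral_mono (integrable_solutionFourier ha0 ha1 m).norm ((hI1.add hI2).const_mul c)
      fun w => norm_solutionFourier_le ha0 m w
  rw [integral_const_mul, integral_add hI1 hI2, integral_const_mul, integral_abs_pow_mul_exp hb0,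
    integral_abs_pow_mul_exp hb0] at h1
  have hx : 0 < ((m + 1 : ℕ) : ℝ) / 2 := by positivity
  have e1 : -((m : ℝ) + 1) / 2 = -((m + 1 : ℕ) : ℝ) / 2 := by push_cast; ring
  have e2 : ((m : ℝ) + 1) / 2 = ((m + 1 : ℕ) : ℝ) / 2 := by push_cast; ring
  have e3 : -(((m + 2 : ℕ) : ℝ) + 1) / 2 = -((m + 1 : ℕ) : ℝ) / 2 - 1 := by push_cast; ring
  have e4 : (((m + 2 : ℕ) : ℝ) + 1) / 2 = ((m + 1 : ℕ) : ℝ) / 2 + 1 := by push_cast; ring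
  rw [e1, e2, e3, e4, Real.rpow_sub hb0, Real.rpow_one] at h1
  have hG : Real.Gamma (((m + 1 : ℕ) : ℝ) / 2) ≤ 2 * Real.Gamma (((m + 1 : ℕ) : ℝ) / 2 + 1) := by
    rw [Real.Gamma_add_one hx.ne', ← mul_assoc]
    refine le_mul_of_one_le_left (Real.Gamma_pos_of_pos hx).le ?_
    push_cast
    have : (0 : ℝ) ≤ m := m.cast_nonneg
    linarith
  have hmain := rpow_mul_Gamma_le_hermiteNorm ha0 ha1 hn
  rw [← hb] at hmain
  set R := b ^ (-((m + 1 : ℕ) : ℝ) / 2) with hR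
  have hR0 : 0 < R := by positivity
  set G := Real.Gamma (((m + 1 : ℕ) : ℝ) / 2 + 1) with hGdef
  calc _ ≤ _ := h1
    _ ≤ c * (R * (2 * G) + a * (R / b * G)) := by gcongr
    _ = c * (2 + a / b) * (R * G) := by ring
    _ ≤ c * (2 + a / b) * _ := mul_le_mul_of_nonneg_left hmain (by positivity)
    _ = _ := by ring

/-- The Hermite functions, multiplied by a Gaussian, are transforms of bounded functions `h` under
the odd kernel, with `sup |h| = O(n ^ (1/4))`. -/
theorem exists_oddKernel_preimage_hermiteFun {a : ℝ} (ha0 : 0 < a) (ha1 : a < 1) :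
    ∃ C : ℝ, 0 ≤ C ∧ ∀ n : ℕ, 1 ≤ n → ∃ h : ℝ → ℂ, Continuous h ∧
      (∀ y, ‖h y‖ ≤ C * (n : ℝ) ^ (1 / 4 : ℝ)) ∧ Tendsto h (cocompact ℝ) (nhds 0) ∧
      ∀ x, ∫ y : ℝ, (oddKernel a (x - a * y) : ℂ) * h y
        = ((Real.exp (-(x ^ 2 / (2 * hermiteVar a))) * hermiteFun a n x : ℝ) : ℂ) := by
  obtain ⟨C, hC, hbound⟩ := exists_integral_norm_solutionFourier_le ha0 ha1
  refine ⟨C, hC, fun n hn => ?_⟩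
  have hK := hermiteNorm_pos ha0 ha1 n
  have hb := hbound n hn
  obtain ⟨m, rfl⟩ : ∃ m, n = m + 1 := ⟨n - 1, by omega⟩
  refine ⟨fun y => ((hermiteNorm a (m + 1) : ℝ) : ℂ)⁻¹ * solution a (m + 1) y,
    (continuous_solution ha0 ha1 m).const_mul _, fun y => ?_, ?_, fun x => ?_⟩
  · rw [norm_mul, norm_inv, Complex.norm_real, Real.norm_eq_abs, abs_of_pos hK, inv_mul_le_iff₀ hK]
    exact (norm_solution_le_integral a (m + 1) y).trans (hb.trans_eq (by ring))
  · simpa using (tendsto_solution ha0 (m + 1)).const_mul ((hermiteNorm a (m + 1) : ℝ) : ℂ)⁻¹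
  · simp_rw [mul_left_comm _ ((hermiteNorm a (m + 1) : ℝ) : ℂ)⁻¹]
    rw [integral_const_mul, integral_oddKernel_mul_solution ha0 ha1, hermiteFun, Real.exp_neg]
    have := (Real.exp_pos (x ^ 2 / (2 * hermiteVar a))).ne'
    rw [← Complex.ofReal_inv, ← Complex.ofReal_mul]
    congr 1
    field_simp

/-! ### Medians of the posterior -/

/-- The unnormalized posterior density of `X` given `Y = y`. -/
noncomputable def posteriorWeight (f : ℝ → ℝ) (y x : ℝ) : ℝ := f x * Real.exp (-(x - y) ^ 2 / 2)

theorem posteriorWeight_nonneg {f : ℝ → ℝ} (hf0 : ∀ x, 0 ≤ f x) (y x : ℝ) :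
    0 ≤ posteriorWeight f y x := mul_nonneg (hf0 x) (Real.exp_pos _).le

theorem posteriorWeight_le {f : ℝ → ℝ} (hf0 : ∀ x, 0 ≤ f x) (y x : ℝ) :
    posteriorWeight f y x ≤ f x := by
  refine mul_le_of_le_one_right (hf0 x) (Real.exp_le_one_iff.2 ?_)
  have := sq_nonneg (x - y)
  linarith

theorem integrable_posteriorWeight {f : ℝ → ℝ} (hf0 : ∀ x, 0 ≤ f x) (hfi : Integrable f) (y : ℝ) :
    Integrable (posteriorWeight f y) := by
  refine hfi.mono' (hfi.aestronglyMeasurable.mul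
    (by fun_prop : Continuous _).aestronglyMeasurable) (Eventually.of_forall fun x => ?_)
  rw [Real.norm_eq_abs, abs_of_nonneg (posteriorWeight_nonneg hf0 y x)]
  exact posteriorWeight_le hf0 y x

theorem setLIntegral_gaussianPDF_withDensity {f : ℝ → ℝ} (hf : Measurable f) (hf0 : ∀ x, 0 ≤ f x)
    (hfi : Integrable f) (y : ℝ) {S : Set ℝ} (hS : MeasurableSet S) :
    ∫⁻ x in S, gaussianPDF x 1 y ∂(volume.withDensity fun x => ENNReal.ofReal (f x))
      = ENNReal.ofReal ((√(2 * Real.pi))⁻¹ * ∫ x in S, posteriorWeight f y x) := by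
  rw [setLIntegral_withDensity_eq_setLIntegral_mul _ (by fun_prop) (measurable_gaussianPDF_left y)
    hS, ← integral_const_mul, ofReal_integral_eq_lintegral_ofReal]
  · refine lintegral_congr fun x => ?_
    rw [Pi.mul_apply, gaussianPDF, ← ENNReal.ofReal_mul (hf0 x), gaussianPDFReal_def]
    congr 1
    simp only [posteriorWeight, NNReal.coe_one, mul_one]
    rw [show -(y - x) ^ 2 = -(x - y) ^ 2 by ring]
    ring
  · exact ((integrable_posteriorWeight hf0 hfi y).const_mul _).integrableOn
  · exact Eventually.of_forall fun x =>
      mul_nonneg (by positivity) (posteriorWeight_nonneg hf0 y x)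

theorem gaussianPosterior_apply {f : ℝ → ℝ} (hf : Measurable f) (hf0 : ∀ x, 0 ≤ f x)
    (hfi : Integrable f) (y : ℝ) (hpos : 0 < ∫ x, posteriorWeight f y x)
    {S : Set ℝ} (hS : MeasurableSet S) :
    gaussianPosterior (volume.withDensity fun x => ENNReal.ofReal (f x)) y S
      = ENNReal.ofReal ((∫ x in S, posteriorWeight f y x) / ∫ x, posteriorWeight f y x) := by
  have hu := setLIntegral_gaussianPDF_withDensity hf hf0 hfi y MeasurableSet.univ
  rw [setLIntegral_univ, setIntegral_univ] at hu
  have hc : 0 < (√(2 * Real.pi))⁻¹ := by positivity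
  rw [gaussianPosterior, Measure.smul_apply, withDensity_apply _ hS,
    setLIntegral_gaussianPDF_withDensity hf hf0 hfi y hS, hu, smul_eq_mul,
    ← ENNReal.ofReal_inv_of_pos (mul_pos hc hpos),
    ← ENNReal.ofReal_mul (inv_nonneg.2 (mul_pos hc hpos).le)]
  congr 1
  field_simp

theorem integral_posteriorWeight_pos {f : ℝ → ℝ} (hf : Measurable f) (hf0 : ∀ x, 0 ≤ f x)
    (hfi : Integrable f)
    [IsProbabilityMeasure (volume.withDensity fun x => ENNReal.ofReal (f x))] (y : ℝ) :
    0 < ∫ x, posteriorWeight f y x := by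
  have hu := setLIntegral_gaussianPDF_withDensity hf hf0 hfi y MeasurableSet.univ
  rw [setLIntegral_univ, setIntegral_univ] at hu
  have hne := lintegral_gaussianPDF_ne_zero
    (volume.withDensity fun x => ENNReal.ofReal (f x)) y
  rw [hu] at hne
  have := ENNReal.ofReal_pos.1 (pos_iff_ne_zero.2 hne)
  exact pos_of_mul_pos_right this (by positivity)

/-- A median of the posterior splits the unnormalized posterior into two equal halves. -/
theorem IsMedian.half_mass {f : ℝ → ℝ} (hf : Measurable f) (hf0 : ∀ x, 0 ≤ f x)
    (hfi : Integrable f)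
    [IsProbabilityMeasure (volume.withDensity fun x => ENNReal.ofReal (f x))] {y m : ℝ}
    (hm : IsMedian (gaussianPosterior (volume.withDensity fun x => ENNReal.ofReal (f x)) y) m) :
    ∫ x in Set.Iio m, posteriorWeight f y x = (∫ x, posteriorWeight f y x) / 2 ∧
      ∫ x in Set.Ioi m, posteriorWeight f y x = (∫ x, posteriorWeight f y x) / 2 := by
  have hpos := integral_posteriorWeight_pos hf hf0 hfi y
  have hW := integrable_posteriorWeight hf0 hfi y
  obtain ⟨h1, h2⟩ := hm
  have key : ∀ S, MeasurableSet S →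
      1 / 2 ≤ gaussianPosterior (volume.withDensity fun x => ENNReal.ofReal (f x)) y S →
      (∫ x, posteriorWeight f y x) / 2 ≤ ∫ x in S, posteriorWeight f y x := by
    intro S hS h
    rw [gaussianPosterior_apply hf hf0 hfi y hpos hS,
      show (1 / 2 : ℝ≥0∞) = ENNReal.ofReal (1 / 2) by
        rw [ENNReal.ofReal_div_of_pos two_pos]; simp] at h
    have hnn : 0 ≤ ∫ x in S, posteriorWeight f y x :=
      integral_nonneg fun x => posteriorWeight_nonneg hf0 y x
    rw [ENNReal.ofReal_le_ofReal_iff (by positivity), div_le_div_iff₀ two_pos hpos] at h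
    linarith
  have k1 := key _ measurableSet_Iic h1
  have k2 := key _ measurableSet_Ici h2
  have hsum : (∫ x in Set.Iic m, posteriorWeight f y x) + ∫ x in Set.Ioi m, posteriorWeight f y x
      = ∫ x, posteriorWeight f y x := by
    rw [← Set.compl_Iic]
    exact integral_add_compl measurableSet_Iic hW
  rw [integral_Iic_eq_integral_Iio] at k1 hsum
  rw [integral_Ici_eq_integral_Ioi] at k2
  constructor <;> linarith

theorem integral_posteriorWeight_mul_sign {f : ℝ → ℝ} (hf : Measurable f) (hf0 : ∀ x, 0 ≤ f x)
    (hfi : Integrable f)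
    [IsProbabilityMeasure (volume.withDensity fun x => ENNReal.ofReal (f x))] {y m : ℝ}
    (hm : IsMedian (gaussianPosterior (volume.withDensity fun x => ENNReal.ofReal (f x)) y) m) :
    ∫ x, posteriorWeight f y x * Real.sign (x - m) = 0 := by
  have hW := integrable_posteriorWeight hf0 hfi y
  obtain ⟨h1, h2⟩ := hm.half_mass hf hf0 hfi
  have hi : Integrable fun x => posteriorWeight f y x * Real.sign (x - m) := by
    refine hW.mul_bdd (c := 1) ?_ (Eventually.of_forall fun x => abs_real_sign_le _)
    exact (measurable_real_sign.comp (measurable_id.sub_const m)).aestronglyMeasurable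
  rw [← integral_add_compl (measurableSet_Iic (a := m)) hi, Set.compl_Iic,
    integral_Iic_eq_integral_Iio]
  have e1 : ∫ x in Set.Iio m, posteriorWeight f y x * Real.sign (x - m)
      = ∫ x in Set.Iio m, -posteriorWeight f y x := by
    refine setIntegral_congr_fun measurableSet_Iio fun x hx => ?_
    rw [Real.sign_of_neg (sub_neg.2 hx)]
    ring
  have e2 : ∫ x in Set.Ioi m, posteriorWeight f y x * Real.sign (x - m)
      = ∫ x in Set.Ioi m, posteriorWeight f y x := by
    refine setIntegral_congr_fun measurableSet_Ioi fun x hx => ?_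
    rw [Real.sign_of_pos (sub_pos.2 hx), mul_one]
  rw [e1, e2, integral_neg, h1, h2]
  ring

/-- The posteriors have a strictly monotone likelihood ratio, so that their medians are strictly
increasing. -/
theorem strictMono_of_isMedian {f : ℝ → ℝ} (hf : Measurable f) (hf0 : ∀ x, 0 ≤ f x)
    (hfi : Integrable f)
    [IsProbabilityMeasure (volume.withDensity fun x => ENNReal.ofReal (f x))] {ψ : ℝ → ℝ}
    (hψ : ∀ y, IsMedian
      (gaussianPosterior (volume.withDensity fun x => ENNReal.ofReal (f x)) y) (ψ y)) :
    StrictMono ψ := by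
  intro y y' hy
  by_contra! hle
  have hW := integrable_posteriorWeight hf0 hfi y
  have hW' := integrable_posteriorWeight hf0 hfi y'
  obtain ⟨h1, h2⟩ := (hψ y).half_mass hf hf0 hfi
  obtain ⟨h1', h2'⟩ := (hψ y').half_mass hf hf0 hfi
  have hpos' := integral_posteriorWeight_pos hf hf0 hfi y'
  set t := ψ y
  set t' := ψ y'
  set c := Real.exp (-(y' ^ 2 - y ^ 2) / 2)
  have hratio : ∀ x, posteriorWeight f y' x
      = c * Real.exp ((y' - y) * x) * posteriorWeight f y x := by
    intro x
    rw [posteriorWeight, posteriorWeight, mul_left_comm, ← Real.exp_add, ← Real.exp_add]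
    congr 2
    ring
  set A := c * Real.exp ((y' - y) * t') with hA
  have hA0 : 0 < A := by positivity
  have b1 : ∫ x in Set.Iio t', posteriorWeight f y' x
      ≤ ∫ x in Set.Iio t', A * posteriorWeight f y x := by
    refine setIntegral_mono_on hW'.integrableOn (hW.const_mul _).integrableOn measurableSet_Iio
      fun x hx => ?_
    rw [hratio]
    refine mul_le_mul_of_nonneg_right ?_ (posteriorWeight_nonneg hf0 y x)
    have : x ≤ t' := le_of_lt hx
    rw [hA]
    gcongr
  have b2 : ∫ x in Set.Iio t', posteriorWeight f y x ≤ ∫ x in Set.Iio t, posteriorWeight f y x :=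
    setIntegral_mono_set hW.integrableOn
      (Eventually.of_forall fun x => posteriorWeight_nonneg hf0 y x)
      (Set.Iio_subset_Iio hle).eventuallyLE
  have b3 : ∫ x in Set.Ioi t, posteriorWeight f y x ≤ ∫ x in Set.Ioi t', posteriorWeight f y x :=
    setIntegral_mono_set hW.integrableOn
      (Eventually.of_forall fun x => posteriorWeight_nonneg hf0 y x)
      (Set.Ioi_subset_Ioi hle).eventuallyLE
  have hnn : ∀ x ∈ Set.Ioi t', 0 ≤ posteriorWeight f y' x - A * posteriorWeight f y x := by
    intro x hx
    rw [hratio, ← sub_mul]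
    refine mul_nonneg (sub_nonneg.2 ?_) (posteriorWeight_nonneg hf0 y x)
    have : t' ≤ x := le_of_lt hx
    rw [hA]
    gcongr
  have hint : IntegrableOn (fun x => posteriorWeight f y' x - A * posteriorWeight f y x)
      (Set.Ioi t') := (hW'.sub (hW.const_mul A)).integrableOn
  have b4 : ∫ x in Set.Ioi t', (posteriorWeight f y' x - A * posteriorWeight f y x) ≤ 0 := by
    rw [integral_sub hW'.integrableOn (hW.const_mul A).integrableOn, integral_const_mul]
    rw [integral_const_mul] at b1
    nlinarith
  have b5 : ∫ x in Set.Ioi t', (posteriorWeight f y' x - A * posteriorWeight f y x) = 0 :=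
    le_antisymm b4 (setIntegral_nonneg measurableSet_Ioi hnn)
  rw [setIntegral_eq_zero_iff_of_nonneg_ae
    ((ae_restrict_iff' measurableSet_Ioi).2 (Eventually.of_forall hnn)) hint] at b5
  -- equality in the comparison forces the posterior to have no mass above `t'`
  have b6 : ∫ x in Set.Ioi t', posteriorWeight f y' x = 0 := by
    refine integral_eq_zero_of_ae ?_
    filter_upwards [b5, ae_restrict_mem measurableSet_Ioi] with x hx hx'
    rw [Pi.zero_apply] at hx ⊢
    rw [hratio, ← sub_mul] at hx
    rw [hratio]
    rcases mul_eq_zero.1 hx with h | h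
    · exfalso
      have : Real.exp ((y' - y) * t') < Real.exp ((y' - y) * x) :=
        Real.exp_lt_exp.2 (mul_lt_mul_of_pos_left hx' (sub_pos.2 hy))
      have := mul_lt_mul_of_pos_left this (Real.exp_pos (-(y' ^ 2 - y ^ 2) / 2))
      rw [← hA] at this
      linarith
    · rw [h, mul_zero]
  linarith

/-! ### Local mass of the tilted density -/

/-- The density `f` divided by the Gaussian `exp (-x² / (2σ²))`. -/
noncomputable def tiltedDensity (a : ℝ) (f : ℝ → ℝ) (x : ℝ) : ℝ :=
  f x * Real.exp (x ^ 2 / (2 * hermiteVar a))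

theorem tiltedDensity_nonneg (a : ℝ) {f : ℝ → ℝ} (hf0 : ∀ x, 0 ≤ f x) (x : ℝ) :
    0 ≤ tiltedDensity a f x := mul_nonneg (hf0 x) (Real.exp_pos _).le

theorem measurable_tiltedDensity (a : ℝ) {f : ℝ → ℝ} (hf : Measurable f) :
    Measurable (tiltedDensity a f) := by
  unfold tiltedDensity
  fun_prop

/-- Completing the square in `x`. -/
theorem tiltedDensity_mul_exp {a : ℝ} (ha0 : 0 < a) (ha1 : a < 1) (f : ℝ → ℝ) (x y : ℝ) :
    tiltedDensity a f x * Real.exp (-(x - a * y) ^ 2 / (2 * a))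
      = Real.exp ((1 - a) / 2 * y ^ 2) * posteriorWeight f y x := by
  rw [tiltedDensity, posteriorWeight, mul_left_comm, mul_assoc, ← Real.exp_add, ← Real.exp_add]
  congr 2
  have : 1 - a ≠ 0 := by linarith
  rw [hermiteVar]
  field_simp
  ring

/-- The transform of the tilted density under the odd kernel; it vanishes identically when
`y ↦ a * y` is the conditional median. -/
noncomputable def oddTransform (a : ℝ) (f : ℝ → ℝ) (y : ℝ) : ℝ :=
  ∫ x, tiltedDensity a f x * oddKernel a (x - a * y)

theorem abs_tiltedDensity_mul_oddKernel_le {a : ℝ} {f : ℝ → ℝ} (hf0 : ∀ x, 0 ≤ f x) (x y : ℝ) :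
    |tiltedDensity a f x * oddKernel a (x - a * y)|
      ≤ tiltedDensity a f x * Real.exp (-(x - a * y) ^ 2 / (2 * a)) := by
  rw [abs_mul, abs_of_nonneg (tiltedDensity_nonneg a hf0 x)]
  exact mul_le_mul_of_nonneg_left (abs_oddKernel_le _ _) (tiltedDensity_nonneg a hf0 x)

theorem measurable_tiltedDensity_mul_oddKernel (a : ℝ) {f : ℝ → ℝ} (hf : Measurable f) :
    Measurable fun p : ℝ × ℝ => tiltedDensity a f p.2 * oddKernel a (p.2 - a * p.1) :=
  ((measurable_tiltedDensity a hf).comp measurable_snd).mul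
    ((measurable_oddKernel a).comp (by fun_prop))

theorem stronglyMeasurable_oddTransform (a : ℝ) {f : ℝ → ℝ} (hf : Measurable f) :
    StronglyMeasurable (oddTransform a f) :=
  (measurable_tiltedDensity_mul_oddKernel a hf).stronglyMeasurable.integral_prod_right

/-- The tail integral of the odd kernel: a positive even function. -/
noncomputable def oddKernelTail (a s : ℝ) : ℝ := ∫ t in Set.Ioi s, oddKernel a t

theorem integral_oddKernel (a : ℝ) : ∫ t, oddKernel a t = 0 := by
  have h := integral_neg_eq_self (oddKernel a) volume
  simp only [oddKernel_neg, integral_neg] at h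
  linarith

theorem oddKernelTail_neg {a : ℝ} (ha : 0 < a) (s : ℝ) :
    oddKernelTail a (-s) = oddKernelTail a s := by
  have h1 := integral_comp_neg_Ioi (-s) (oddKernel a)
  simp only [oddKernel_neg, integral_neg, neg_neg] at h1
  have h2 := integral_add_compl (measurableSet_Iic (a := s)) (integrable_oddKernel ha)
  rw [Set.compl_Iic, integral_oddKernel] at h2
  unfold oddKernelTail
  linarith

theorem oddKernelTail_of_nonneg (a : ℝ) {s : ℝ} (hs : 0 ≤ s) :
    oddKernelTail a s = ∫ t in Set.Ioi s, Real.exp (-t ^ 2 / (2 * a)) := by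
  refine setIntegral_congr_fun measurableSet_Ioi fun t ht => ?_
  rw [oddKernel, Real.sign_of_pos (lt_of_le_of_lt hs ht), one_mul]

theorem oddKernelTail_nonneg {a : ℝ} (ha : 0 < a) (s : ℝ) : 0 ≤ oddKernelTail a s := by
  wlog hs : 0 ≤ s generalizing s
  · rw [← oddKernelTail_neg ha]
    exact this (-s) (by linarith)
  rw [oddKernelTail_of_nonneg a hs]
  exact integral_nonneg fun t => (Real.exp_pos _).le

theorem oddKernelTail_le {a : ℝ} (ha : 0 < a) (s : ℝ) :
    oddKernelTail a s
      ≤ (∫ t : ℝ, Real.exp (-t ^ 2 / (2 * a))) * Real.exp (-s ^ 2 / (2 * a)) := by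
  wlog hs : 0 ≤ s generalizing s
  · rw [← oddKernelTail_neg ha, ← neg_sq s]
    exact this (-s) (by linarith)
  have hI := integrable_exp_neg_sq_div ha
  have hI' : Integrable fun t : ℝ => Real.exp (-(t - s) ^ 2 / (2 * a)) * Real.exp (-s ^ 2 / (2 * a)) :=
    (hI.comp_sub_right s).mul_const _
  rw [oddKernelTail_of_nonneg a hs]
  calc ∫ t in Set.Ioi s, Real.exp (-t ^ 2 / (2 * a))
      ≤ ∫ t in Set.Ioi s, Real.exp (-(t - s) ^ 2 / (2 * a)) * Real.exp (-s ^ 2 / (2 * a)) := by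
        refine setIntegral_mono_on hI.integrableOn hI'.integrableOn measurableSet_Ioi fun t ht => ?_
        rw [← Real.exp_add, Real.exp_le_exp, ← add_div]
        refine div_le_div_of_nonneg_right ?_ (by positivity)
        have : s < t := ht
        nlinarith
    _ ≤ ∫ t, Real.exp (-(t - s) ^ 2 / (2 * a)) * Real.exp (-s ^ 2 / (2 * a)) :=
        setIntegral_le_integral hI' (Eventually.of_forall fun t => by positivity)
    _ = _ := by
        rw [integral_mul_const, integral_sub_right_eq_self
          (fun t : ℝ => Real.exp (-t ^ 2 / (2 * a)))]

theorem oddKernelTail_one_pos {a : ℝ} (ha : 0 < a) : 0 < oddKernelTail a 1 := by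
  rw [oddKernelTail_of_nonneg a zero_le_one]
  have h := integrable_exp_neg_sq_div ha
  rw [setIntegral_pos_iff_support_of_nonneg_ae (Eventually.of_forall fun t => (Real.exp_pos _).le)
    h.integrableOn]
  have : Function.support (fun t : ℝ => Real.exp (-t ^ 2 / (2 * a))) = Set.univ :=
    Set.eq_univ_of_forall fun t => (Real.exp_pos _).ne'
  simp [this]

theorem oddKernelTail_one_le {a : ℝ} (ha : 0 < a) {s : ℝ} (hs : |s| ≤ 1) :
    oddKernelTail a 1 ≤ oddKernelTail a s := by
  wlog h0 : 0 ≤ s generalizing s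
  · rw [← oddKernelTail_neg ha s]
    exact this (by rwa [abs_neg]) (by linarith)
  rw [oddKernelTail_of_nonneg a h0, oddKernelTail_of_nonneg a zero_le_one]
  exact setIntegral_mono_set (integrable_exp_neg_sq_div ha).integrableOn
    (Eventually.of_forall fun t => (Real.exp_pos _).le)
    (Set.Ioi_subset_Ioi ((le_abs_self s).trans hs)).eventuallyLE

theorem integrable_tiltedDensity_mul_exp {a : ℝ} (ha0 : 0 < a) (ha1 : a < 1) {f : ℝ → ℝ}
    (hf0 : ∀ x, 0 ≤ f x) (hfi : Integrable f) (y : ℝ) :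
    Integrable fun x => tiltedDensity a f x * Real.exp (-(x - a * y) ^ 2 / (2 * a)) := by
  simp_rw [tiltedDensity_mul_exp ha0 ha1]
  exact (integrable_posteriorWeight hf0 hfi y).const_mul _

theorem measurable_oddKernelTail {a : ℝ} (ha : 0 < a) : Measurable (oddKernelTail a) := by
  have : ∀ s, oddKernelTail a s = oddKernelTail a 0 - ∫ t in (0 : ℝ)..s, oddKernel a t := by
    intro s
    rw [oddKernelTail, oddKernelTail, ← intervalIntegral.integral_Ioi_sub_Ioi'
      (integrable_oddKernel ha).integrableOn (integrable_oddKernel ha).integrableOn]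
    ring
  rw [funext this]
  exact (continuous_const.sub (intervalIntegral.continuous_primitive
    (fun _ _ => (integrable_oddKernel ha).intervalIntegrable) 0)).measurable

theorem integrable_tiltedDensity_mul_tail {a : ℝ} (ha0 : 0 < a) (ha1 : a < 1) {f : ℝ → ℝ}
    (hf : Measurable f) (hf0 : ∀ x, 0 ≤ f x) (hfi : Integrable f) (y : ℝ) :
    Integrable fun x => tiltedDensity a f x * oddKernelTail a (x - a * y) := by
  refine ((integrable_tiltedDensity_mul_exp ha0 ha1 hf0 hfi y).const_mul
    (∫ t : ℝ, Real.exp (-t ^ 2 / (2 * a)))).mono'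
    ((measurable_tiltedDensity a hf).mul ((measurable_oddKernelTail ha0).comp
      (by fun_prop))).aestronglyMeasurable (Eventually.of_forall fun x => ?_)
  rw [Real.norm_eq_abs, abs_of_nonneg (mul_nonneg (tiltedDensity_nonneg a hf0 x)
    (oddKernelTail_nonneg ha0 _)), mul_left_comm]
  exact mul_le_mul_of_nonneg_left (oddKernelTail_le ha0 _) (tiltedDensity_nonneg a hf0 x)

/-- The tail transform of the tilted density is, up to the factor `a`, a primitive of the odd
transform. -/
theorem integral_tiltedDensity_mul_tail_sub {a : ℝ} (ha0 : 0 < a) (ha1 : a < 1) {f : ℝ → ℝ}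
    (hf : Measurable f) (hf0 : ∀ x, 0 ≤ f x) (hfi : Integrable f) (w : ℝ) :
    (∫ x, tiltedDensity a f x * oddKernelTail a (x - a * w))
      - ∫ x, tiltedDensity a f x * oddKernelTail a x
      = a * ∫ y in (0 : ℝ)..w, oddTransform a f y := by
  have hprod : Integrable (Function.uncurry fun y x : ℝ =>
      tiltedDensity a f x * oddKernel a (x - a * y))
      ((volume.restrict (Set.uIoc 0 w)).prod volume) := by
    have hb : Integrable (fun _ : ℝ => Real.exp ((1 - a) / 2 * w ^ 2))
      (volume.restrict (Set.uIoc 0 w)) := by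
      rw [← IntegrableOn, ← intervalIntegrable_iff]
      exact intervalIntegrable_const
    refine (hb.mul_prod hfi).mono'
      (measurable_tiltedDensity_mul_oddKernel a hf).aestronglyMeasurable ?_
    have hmem : ∀ᵐ p ∂((volume.restrict (Set.uIoc 0 w)).prod (volume : Measure ℝ)),
        p.1 ∈ Set.uIoc 0 w :=
      Measure.quasiMeasurePreserving_fst.ae (ae_restrict_mem measurableSet_uIoc)
    filter_upwards [hmem] with p hp
    refine (abs_tiltedDensity_mul_oddKernel_le hf0 p.2 p.1).trans ?_
    rw [tiltedDensity_mul_exp ha0 ha1]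
    have hsq : p.1 ^ 2 ≤ w ^ 2 := by
      rcases Set.mem_uIoc.1 hp with h | h <;> nlinarith
    have h1a : 0 ≤ (1 - a) / 2 := by linarith
    exact mul_le_mul (Real.exp_le_exp.2 (mul_le_mul_of_nonneg_left hsq h1a))
      (posteriorWeight_le hf0 _ _) (posteriorWeight_nonneg hf0 _ _) (Real.exp_pos _).le
  have hswap := intervalIntegral_integral_swap hprod
  unfold oddTransform
  rw [hswap, ← integral_const_mul]
  have h0 := integrable_tiltedDensity_mul_tail ha0 ha1 hf hf0 hfi 0
  simp only [mul_zero, sub_zero] at h0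
  rw [← integral_sub (integrable_tiltedDensity_mul_tail ha0 ha1 hf hf0 hfi w) h0]
  congr 1
  ext x
  rw [intervalIntegral.integral_const_mul, intervalIntegral.integral_comp_sub_mul _ ha0.ne',
    ← intervalIntegral.integral_Ioi_sub_Ioi' (integrable_oddKernel ha0).integrableOn
      (integrable_oddKernel ha0).integrableOn, mul_zero, sub_zero, ← oddKernelTail,
      ← oddKernelTail, smul_eq_mul]
  field_simp

/-- The local mass of the tilted density is controlled by the `L¹` norm of its odd transform: the
tail transform has that variation, is bounded at the origin because `f` is a probability density,
and dominates the local mass. -/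
theorem lintegral_tiltedDensity_Icc_le {a : ℝ} (ha0 : 0 < a) (ha1 : a < 1) {f : ℝ → ℝ}
    (hf : Measurable f) (hf0 : ∀ x, 0 ≤ f x) (hfi : Integrable f) (hf1 : ∫ x, f x = 1) {G : ℝ}
    (hgi : Integrable (oddTransform a f)) (hG : ∫ y, |oddTransform a f y| ≤ G) (t : ℝ) :
    ∫⁻ x in Set.Icc (t - 1) (t + 1), ENNReal.ofReal (tiltedDensity a f x)
      ≤ ENNReal.ofReal (((∫ t : ℝ, Real.exp (-t ^ 2 / (2 * a))) + a * G) / oddKernelTail a 1) := by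
  have hp1 := oddKernelTail_one_pos ha0
  set w := t / a with hw
  have haw : a * w = t := by rw [hw]; field_simp
  have hsub := integral_tiltedDensity_mul_tail_sub ha0 ha1 hf hf0 hfi w
  have hQi := integrable_tiltedDensity_mul_tail ha0 ha1 hf hf0 hfi w
  rw [haw] at hsub hQi
  have h1 : ∫ y in (0 : ℝ)..w, oddTransform a f y ≤ G := by
    refine (Real.le_norm_self _).trans (intervalIntegral.norm_integral_le_integral_norm_uIoc.trans ?_)
    exact (setIntegral_le_integral hgi.norm (Eventually.of_forall fun y => norm_nonneg _)).trans hG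
  have h2 : ∫ x, tiltedDensity a f x * oddKernelTail a x
      ≤ ∫ t : ℝ, Real.exp (-t ^ 2 / (2 * a)) := by
    have h0 := integrable_tiltedDensity_mul_tail ha0 ha1 hf hf0 hfi 0
    simp only [mul_zero, sub_zero] at h0
    calc ∫ x, tiltedDensity a f x * oddKernelTail a x
        ≤ ∫ x, (∫ t : ℝ, Real.exp (-t ^ 2 / (2 * a))) * f x := by
          refine integral_mono h0 (hfi.const_mul _) fun x => ?_
          simp only
          have h3 := tiltedDensity_mul_exp ha0 ha1 f x 0
          simp only [mul_zero, sub_zero, ne_eq, OfNat.ofNat_ne_zero, not_false_eq_true, zero_pow,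
            Real.exp_zero, one_mul] at h3
          refine (mul_le_mul_of_nonneg_left (oddKernelTail_le ha0 x)
            (tiltedDensity_nonneg a hf0 x)).trans ?_
          rw [mul_left_comm, h3]
          exact mul_le_mul_of_nonneg_left (posteriorWeight_le hf0 0 x)
            (integral_nonneg fun t => (Real.exp_pos _).le)
      _ = _ := by rw [integral_const_mul, hf1, mul_one]
  have h3 : ∫ x, tiltedDensity a f x * oddKernelTail a (x - t)
      ≤ (∫ t : ℝ, Real.exp (-t ^ 2 / (2 * a))) + a * G := by
    have := mul_le_mul_of_nonneg_left h1 ha0.le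
    linarith
  calc ∫⁻ x in Set.Icc (t - 1) (t + 1), ENNReal.ofReal (tiltedDensity a f x)
      ≤ ∫⁻ x in Set.Icc (t - 1) (t + 1), ENNReal.ofReal
          ((oddKernelTail a 1)⁻¹ * (tiltedDensity a f x * oddKernelTail a (x - t))) := by
        refine setLIntegral_mono' measurableSet_Icc fun x hx => ENNReal.ofReal_le_ofReal ?_
        rw [mul_left_comm]
        refine le_mul_of_one_le_right (tiltedDensity_nonneg a hf0 x) ?_
        rw [inv_mul_eq_div, one_le_div hp1]
        refine oddKernelTail_one_le ha0 (abs_le.2 ⟨?_, ?_⟩) <;> linarith [hx.1, hx.2]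
    _ ≤ ∫⁻ x, ENNReal.ofReal
          ((oddKernelTail a 1)⁻¹ * (tiltedDensity a f x * oddKernelTail a (x - t))) :=
        setLIntegral_le_lintegral _ _
    _ = ENNReal.ofReal (∫ x, (oddKernelTail a 1)⁻¹ *
          (tiltedDensity a f x * oddKernelTail a (x - t))) := by
        rw [ofReal_integral_eq_lintegral_ofReal (hQi.const_mul _)]
        exact Eventually.of_forall fun x => mul_nonneg (inv_nonneg.2 hp1.le)
          (mul_nonneg (tiltedDensity_nonneg a hf0 x) (oddKernelTail_nonneg ha0 _))
    _ ≤ _ := by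
        refine ENNReal.ofReal_le_ofReal ?_
        rw [integral_const_mul, inv_mul_eq_div]
        exact div_le_div_of_nonneg_right h3 hp1.le

/-! ### The odd transform is small when the median is nearly linear -/

theorem abs_real_sign_sub_sign_le (x u v : ℝ) :
    |Real.sign (x - u) - Real.sign (x - v)| ≤ (Set.uIcc u v).indicator (fun _ => 2) x := by
  by_cases hx : x ∈ Set.uIcc u v
  · rw [Set.indicator_of_mem hx]
    refine (abs_sub _ _).trans ?_
    linarith [abs_real_sign_le (x - u), abs_real_sign_le (x - v)]
  · rw [Set.indicator_of_notMem hx]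
    rw [Set.mem_uIcc, not_or, not_and_or, not_and_or, not_le, not_le, not_le, not_le] at hx
    obtain ⟨h1, h2⟩ := hx
    have : (x < u ∧ x < v) ∨ (u < x ∧ v < x) := by
      rcases h1 with h1 | h1 <;> rcases h2 with h2 | h2
      · exact Or.inl ⟨h1, h2⟩
      · exact absurd h1 (not_lt.2 (by linarith))
      · exact absurd h1 (not_lt.2 (by linarith))
      · exact Or.inr ⟨h2, h1⟩
    rcases this with ⟨h1, h2⟩ | ⟨h1, h2⟩
    · rw [Real.sign_of_neg (sub_neg.2 h1), Real.sign_of_neg (sub_neg.2 h2)]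
      simp
    · rw [Real.sign_of_pos (sub_pos.2 h1), Real.sign_of_pos (sub_pos.2 h2)]
      simp

theorem abs_oddTransform_le {a : ℝ} (ha0 : 0 < a) (ha1 : a < 1) {f : ℝ → ℝ}
    (hf0 : ∀ x, 0 ≤ f x) (hfi : Integrable f) {y m : ℝ}
    (hm : ∫ x, posteriorWeight f y x * Real.sign (x - m) = 0) :
    |oddTransform a f y| ≤ 2 * ∫ x in Set.uIcc (a * y) m,
      tiltedDensity a f x * Real.exp (-(x - a * y) ^ 2 / (2 * a)) := by
  have hW := integrable_posteriorWeight hf0 hfi y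
  have hi : ∀ m : ℝ, Integrable fun x => posteriorWeight f y x * Real.sign (x - m) := fun m =>
    hW.mul_bdd (c := 1) (measurable_real_sign.comp (measurable_id.sub_const m)).aestronglyMeasurable
      (Eventually.of_forall fun x => abs_real_sign_le _)
  have e1 : oddTransform a f y = ∫ x, Real.exp ((1 - a) / 2 * y ^ 2) *
      (posteriorWeight f y x * Real.sign (x - a * y) - posteriorWeight f y x * Real.sign (x - m)) := by
    rw [integral_const_mul, integral_sub (hi _) (hi m), hm, sub_zero, ← integral_const_mul,
      oddTransform]
    congr 1
    ext x
    rw [← mul_assoc, ← tiltedDensity_mul_exp ha0 ha1, oddKernel]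
    ring
  rw [e1, ← integral_const_mul, ← integral_indicator measurableSet_uIcc]
  refine (abs_integral_le_integral_abs).trans (integral_mono_of_nonneg
    (Eventually.of_forall fun x => abs_nonneg _) ?_ (Eventually.of_forall fun x => ?_))
  · exact ((integrable_tiltedDensity_mul_exp ha0 ha1 hf0 hfi y).const_mul 2).indicator
      measurableSet_uIcc
  · simp only
    rw [← mul_sub, ← mul_assoc, abs_mul, ← tiltedDensity_mul_exp ha0 ha1, abs_of_nonneg
      (mul_nonneg (tiltedDensity_nonneg a hf0 x) (Real.exp_pos _).le)]
    refine (mul_le_mul_of_nonneg_left (abs_real_sign_sub_sign_le x (a * y) m)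
      (mul_nonneg (tiltedDensity_nonneg a hf0 x) (Real.exp_pos _).le)).trans_eq ?_
    by_cases hx : x ∈ Set.uIcc (a * y) m
    · rw [Set.indicator_of_mem hx, Set.indicator_of_mem hx]
      ring
    · rw [Set.indicator_of_notMem hx, Set.indicator_of_notMem hx, mul_zero]

/-- The bound by the weighted distance between the median and the line, valid when the median lies
in the window `[a y - r, a y + r]`. -/
theorem abs_oddTransform_le_of_mem_window {a : ℝ} (ha0 : 0 < a) (ha1 : a < 1) {f : ℝ → ℝ}
    (hf0 : ∀ x, 0 ≤ f x) (hfi : Integrable f) {M : ℝ} (hM : ∀ x, f x ≤ M) {y m r : ℝ}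
    (hm : ∫ x, posteriorWeight f y x * Real.sign (x - m) = 0) (hr : |a * y - m| ≤ r) :
    |oddTransform a f y| ≤ 2 * M * (Real.exp ((1 - a) / 2 * y ^ 2 -
      sInf ((fun x : ℝ => (x - y) ^ 2 / 2) '' Set.Icc (a * y - r) (a * y + r))) * |a * y - m|) := by
  refine (abs_oddTransform_le ha0 ha1 hf0 hfi hm).trans ?_
  rw [mul_assoc]
  refine mul_le_mul_of_nonneg_left ?_ two_pos.le
  set I := sInf ((fun x : ℝ => (x - y) ^ 2 / 2) '' Set.Icc (a * y - r) (a * y + r)) with hI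
  have hbdd : BddBelow ((fun x : ℝ => (x - y) ^ 2 / 2) '' Set.Icc (a * y - r) (a * y + r)) := by
    refine ⟨0, ?_⟩
    rintro _ ⟨x, _, rfl⟩
    positivity
  obtain ⟨hr1, hr2⟩ := abs_le.1 hr
  have hr0 : 0 ≤ r := (abs_nonneg _).trans hr
  have hsub : Set.uIcc (a * y) m ⊆ Set.Icc (a * y - r) (a * y + r) :=
    Set.uIcc_subset_Icc ⟨by linarith, by linarith⟩ ⟨by linarith, by linarith⟩
  have hbound : ∀ x ∈ Set.uIcc (a * y) m,
      ‖tiltedDensity a f x * Real.exp (-(x - a * y) ^ 2 / (2 * a))‖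
        ≤ M * Real.exp ((1 - a) / 2 * y ^ 2 - I) := by
    intro x hx
    rw [Real.norm_eq_abs, abs_of_nonneg (mul_nonneg (tiltedDensity_nonneg a hf0 x)
      (Real.exp_pos _).le), tiltedDensity_mul_exp ha0 ha1, posteriorWeight, mul_left_comm,
      ← Real.exp_add]
    have : I ≤ (x - y) ^ 2 / 2 := csInf_le hbdd ⟨x, hsub hx, rfl⟩
    refine mul_le_mul (hM x) (Real.exp_le_exp.2 ?_) (Real.exp_pos _).le ((hf0 x).trans (hM x))
    rw [neg_div]
    linarith
  have h := norm_setIntegral_le_of_norm_le_const (μ := volume) (s := Set.uIcc (a * y) m)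
    (by rw [Real.volume_interval]; exact ENNReal.ofReal_lt_top) hbound
  rw [measureReal_def, Real.volume_interval, ENNReal.toReal_ofReal (abs_nonneg _), abs_sub_comm m] at h
  exact (Real.le_norm_self _).trans (h.trans_eq (mul_assoc _ _ _))

/-- The points `y` for which a given `x` lies between `a y` and `ψ y` lie between `x / a` and
`ψ⁻¹ x`. The hypothesis `hb` makes `ψ` unbounded in both directions, so that the infimum defining
`ψ⁻¹` is never a junk value. -/
theorem mem_uIcc_monoInverse {a : ℝ} (ha0 : 0 < a) {ψ : ℝ → ℝ} (hψ : StrictMono ψ) {c : ℝ}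
    (hb : ∀ x, |monoInverse ψ x - x / a| ≤ c) {x y : ℝ} (hx : x ∈ Set.uIcc (a * y) (ψ y)) :
    y ∈ Set.uIcc (x / a) (monoInverse ψ x) := by
  have hc : 0 ≤ c := (abs_nonneg _).trans (hb 0)
  -- at a point where `monoInverse` takes the junk value `0`, the bound gives `|t| ≤ a c`
  have hbig : ∀ t, monoInverse ψ t = 0 → |t| ≤ a * c := by
    intro t ht
    have := hb t
    rw [ht, zero_sub, abs_neg, abs_div, abs_of_pos ha0, div_le_iff₀ ha0] at this
    linarith
  have hne : ∃ z, x ≤ ψ z := by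
    by_contra! h
    set t := max x (a * c + 1) with ht
    have : {z | t ≤ ψ z} = ∅ := by
      ext z
      simpa only [Set.mem_ofPred_eq, Set.mem_empty_iff_false, iff_false, not_le] using
        (h z).trans_le (le_max_left x (a * c + 1))
    have h2 := hbig t (by rw [monoInverse, this, Real.sInf_empty])
    have h3 : a * c + 1 ≤ t := le_max_right _ _
    linarith [le_abs_self t]
  have hbdd : BddBelow {z | x ≤ ψ z} := by
    by_contra h
    set t := min x (-(a * c + 1)) with ht
    have hall : ∀ z, x ≤ ψ z := by
      intro z
      obtain ⟨z', hz', hlt⟩ := not_bddBelow_iff.1 h z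
      exact le_trans hz' (hψ.monotone hlt.le)
    have : {z | t ≤ ψ z} = Set.univ := Set.eq_univ_of_forall fun z =>
      (min_le_left x _).trans (hall z)
    have h2 := hbig t (by rw [monoInverse, this, Real.sInf_univ])
    have h3 : t ≤ -(a * c + 1) := min_le_right _ _
    linarith [neg_abs_le t]
  rcases Set.mem_uIcc.1 hx with ⟨h1, h2⟩ | ⟨h1, h2⟩
  · rw [Set.uIcc_comm]
    refine Set.mem_uIcc_of_le (csInf_le hbdd h2) ?_
    rw [le_div_iff₀ ha0]
    linarith
  · refine Set.mem_uIcc_of_le ?_ (le_csInf hne fun z hz => ?_)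
    · rw [div_le_iff₀ ha0]
      linarith
    · exact hψ.le_iff_le.1 (h1.trans hz)

/-- The `L¹` norm of the odd transform, by Tonelli's theorem: for fixed `x` the points `y` for which
`x` lies between `a y` and `ψ y` form a set of measure at most `b ⌊x⌋`. -/
theorem lintegral_oddTransform_le {a : ℝ} (ha0 : 0 < a) (ha1 : a < 1) {f : ℝ → ℝ}
    (hf : Measurable f) (hf0 : ∀ x, 0 ≤ f x) (hfi : Integrable f) {ψ : ℝ → ℝ} (hψ : StrictMono ψ)
    (hbal : ∀ y, ∫ x, posteriorWeight f y x * Real.sign (x - ψ y) = 0)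
    {b : ℤ → ℝ} {ε C : ℝ} (hbs : Summable b) (hbε : ∑' i, b i ≤ ε)
    (hb : ∀ x : ℝ, |monoInverse ψ x - x / a| ≤ b ⌊x⌋)
    (hloc : ∀ t : ℝ, ∫⁻ x in Set.Icc (t - 1) (t + 1), ENNReal.ofReal (tiltedDensity a f x)
      ≤ ENNReal.ofReal C) :
    ∫⁻ y, ‖oddTransform a f y‖ₑ ≤ 2 * (ENNReal.ofReal ε * ENNReal.ofReal C) := by
  have hb0 : ∀ i, 0 ≤ b i := fun i => by
    have := (abs_nonneg _).trans (hb i)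
    rwa [Int.floor_intCast] at this
  have hbound : ∀ x, |monoInverse ψ x - x / a| ≤ ε := fun x =>
    (hb x).trans ((hbs.le_tsum _ fun j _ => hb0 j).trans hbε)
  have hψm : Measurable ψ := hψ.monotone.measurable
  have hFm := measurable_tiltedDensity a hf
  set S : Set (ℝ × ℝ) := {p | p.2 ∈ Set.uIcc (a * p.1) (ψ p.1)} with hS
  have hSm : MeasurableSet S := by
    have h1 : Measurable fun p : ℝ × ℝ => min (a * p.1) (ψ p.1) := by fun_prop
    have h2 : Measurable fun p : ℝ × ℝ => max (a * p.1) (ψ p.1) := by fun_prop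
    exact (measurableSet_le h1 measurable_snd).inter (measurableSet_le measurable_snd h2)
  have hstep1 : ∀ y, ‖oddTransform a f y‖ₑ ≤ 2 * ∫⁻ x, S.indicator
      (fun p => ENNReal.ofReal (tiltedDensity a f p.2)) (y, x) := by
    intro y
    rw [Real.enorm_eq_ofReal_abs]
    refine (ENNReal.ofReal_le_ofReal (abs_oddTransform_le ha0 ha1 hf0 hfi (hbal y))).trans ?_
    rw [ENNReal.ofReal_mul two_pos.le, ENNReal.ofReal_ofNat]
    refine mul_le_mul_right ?_ 2
    rw [ofReal_integral_eq_lintegral_ofReal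
      (integrable_tiltedDensity_mul_exp ha0 ha1 hf0 hfi y).integrableOn
      (Eventually.of_forall fun x => mul_nonneg (tiltedDensity_nonneg a hf0 x) (Real.exp_pos _).le),
      ← lintegral_indicator measurableSet_uIcc]
    refine lintegral_mono fun x => ?_
    by_cases hx : x ∈ Set.uIcc (a * y) (ψ y)
    · have hx' : (y, x) ∈ S := hx
      rw [Set.indicator_of_mem hx, Set.indicator_of_mem hx']
      refine ENNReal.ofReal_le_ofReal (mul_le_of_le_one_right (tiltedDensity_nonneg a hf0 x)
        (Real.exp_le_one_iff.2 ?_))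
      rw [neg_div]
      exact neg_nonpos.2 (by positivity)
    · rw [Set.indicator_of_notMem hx]
      exact zero_le
  have hind : Measurable (S.indicator fun p : ℝ × ℝ => ENNReal.ofReal (tiltedDensity a f p.2)) :=
    (by fun_prop : Measurable _).indicator hSm
  have hstep2 : ∀ x, ∫⁻ y, S.indicator (fun p => ENNReal.ofReal (tiltedDensity a f p.2)) (y, x)
      ≤ ENNReal.ofReal (b ⌊x⌋) * ENNReal.ofReal (tiltedDensity a f x) := by
    intro x
    calc _ ≤ ∫⁻ y, (Set.uIcc (x / a) (monoInverse ψ x)).indicator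
          (fun _ => ENNReal.ofReal (tiltedDensity a f x)) y := by
          refine lintegral_mono fun y => ?_
          by_cases hx : (y, x) ∈ S
          · rw [Set.indicator_of_mem hx,
              Set.indicator_of_mem (mem_uIcc_monoInverse ha0 hψ hbound hx)]
          · rw [Set.indicator_of_notMem hx]
            exact zero_le
      _ = ENNReal.ofReal (tiltedDensity a f x) * ENNReal.ofReal |monoInverse ψ x - x / a| := by
          rw [lintegral_indicator_const measurableSet_uIcc, Real.volume_interval]
      _ ≤ _ := by
          rw [mul_comm]
          exact mul_le_mul_left (ENNReal.ofReal_le_ofReal (hb x)) _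
  calc ∫⁻ y, ‖oddTransform a f y‖ₑ
      ≤ ∫⁻ y, 2 * ∫⁻ x, S.indicator (fun p => ENNReal.ofReal (tiltedDensity a f p.2)) (y, x) :=
        lintegral_mono hstep1
    _ = 2 * ∫⁻ x, ∫⁻ y, S.indicator (fun p => ENNReal.ofReal (tiltedDensity a f p.2)) (y, x) := by
        rw [lintegral_const_mul _ hind.lintegral_prod_right', lintegral_lintegral_swap]
        exact hind.aemeasurable
    _ ≤ 2 * ∫⁻ x, ENNReal.ofReal (b ⌊x⌋) * ENNReal.ofReal (tiltedDensity a f x) :=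
        mul_le_mul_right (lintegral_mono hstep2) 2
    _ = 2 * ∑' i : ℤ, ∫⁻ x in Set.Ico (i : ℝ) (i + 1),
          ENNReal.ofReal (b ⌊x⌋) * ENNReal.ofReal (tiltedDensity a f x) := by
        rw [← lintegral_iUnion (fun i => measurableSet_Ico) (Set.pairwise_disjoint_Ico_intCast ℝ),
          iUnion_Ico_intCast, setLIntegral_univ]
    _ ≤ 2 * ∑' i : ℤ, ENNReal.ofReal (b i) * ENNReal.ofReal C := by
        refine mul_le_mul_right (ENNReal.tsum_le_tsum fun i => ?_) 2
        calc _ = ∫⁻ x in Set.Ico (i : ℝ) (i + 1),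
              ENNReal.ofReal (b i) * ENNReal.ofReal (tiltedDensity a f x) := by
              refine setLIntegral_congr_fun measurableSet_Ico fun x hx => ?_
              rw [Int.floor_eq_iff.2 hx]
          _ = ENNReal.ofReal (b i) * ∫⁻ x in Set.Ico (i : ℝ) (i + 1),
              ENNReal.ofReal (tiltedDensity a f x) := lintegral_const_mul _ (by fun_prop)
          _ ≤ _ := by
              refine mul_le_mul_right (le_trans (lintegral_mono_set ?_) (hloc i)) _
              intro x hx
              exact ⟨by linarith [hx.1], hx.2.le⟩
    _ ≤ 2 * (ENNReal.ofReal ε * ENNReal.ofReal C) := by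
        rw [ENNReal.tsum_mul_right, ← ENNReal.ofReal_tsum_of_nonneg hb0 hbs]
        exact mul_le_mul_right (mul_le_mul_left (ENNReal.ofReal_le_ofReal hbε) _) 2

/-! ### Duality between the tilted density and the solution -/

/-- Uniform bounds on the local mass bound the convolution with a rapidly decaying kernel. -/
theorem exists_lintegral_tiltedDensity_mul_le {a : ℝ} (ha0 : 0 < a) {f : ℝ → ℝ}
    (hf : Measurable f) (hf0 : ∀ x, 0 ≤ f x) {C : ℝ}
    (hloc : ∀ t : ℝ, ∫⁻ x in Set.Icc (t - 1) (t + 1), ENNReal.ofReal (tiltedDensity a f x)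
      ≤ ENNReal.ofReal C) :
    ∃ D : ℝ≥0, ∀ u : ℝ, ∫⁻ x, ENNReal.ofReal (tiltedDensity a f x *
      Real.exp (-(x - u) ^ 2 / (2 * a) + 2 * |x - u|)) ≤ D := by
  have hE : Integrable fun t : ℝ => (1 + t ^ 2)⁻¹ := integrable_inv_one_add_sq
  have hFm := measurable_tiltedDensity a hf
  set K : ℝ := 6 * Real.exp (9 * a / 2) with hK
  have hK0 : 0 ≤ K := by positivity
  -- the kernel is dominated by the average of an integrable one over a unit neighbourhood
  have hker : ∀ s t : ℝ, |s - t| ≤ 1 →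
      Real.exp (-s ^ 2 / (2 * a) + 2 * |s|) ≤ K * (1 + t ^ 2)⁻¹ := by
    intro s t hst
    rw [← div_eq_mul_inv, le_div_iff₀ (by positivity)]
    have h1 : 1 + t ^ 2 ≤ 3 * (1 + s ^ 2) := by
      obtain ⟨h1, h2⟩ := abs_le.1 hst
      nlinarith [sq_nonneg (s + (s - t))]
    have h2 : 1 + s ^ 2 ≤ 2 * Real.exp |s| := by
      have := Real.quadratic_le_exp_of_nonneg (abs_nonneg s)
      rw [sq_abs] at this
      linarith [abs_nonneg s]
    have h3 : Real.exp (-s ^ 2 / (2 * a) + 2 * |s|) * Real.exp |s| ≤ Real.exp (9 * a / 2) := by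
      rw [← Real.exp_add, Real.exp_le_exp]
      have e : 9 * a / 2 - (-s ^ 2 / (2 * a) + 2 * |s| + |s|) = (|s| - 3 * a) ^ 2 / (2 * a) := by
        rw [← sq_abs s]
        field_simp
        ring
      have : 0 ≤ (|s| - 3 * a) ^ 2 / (2 * a) := by positivity
      linarith
    calc _ ≤ Real.exp (-s ^ 2 / (2 * a) + 2 * |s|) * (3 * (2 * Real.exp |s|)) := by
          refine mul_le_mul_of_nonneg_left (h1.trans ?_) (Real.exp_pos _).le
          linarith
      _ = 6 * (Real.exp (-s ^ 2 / (2 * a) + 2 * |s|) * Real.exp |s|) := by ring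
      _ ≤ _ := by rw [hK]; linarith
  have hfin : (∫⁻ t : ℝ, ENNReal.ofReal (K * (1 + t ^ 2)⁻¹)) * ENNReal.ofReal C ≠ ∞ :=
    ENNReal.mul_ne_top (hE.const_mul K).lintegral_lt_top.ne ENNReal.ofReal_ne_top
  refine ⟨((∫⁻ t : ℝ, ENNReal.ofReal (K * (1 + t ^ 2)⁻¹)) * ENNReal.ofReal C).toNNReal,
    fun u => ?_⟩
  rw [ENNReal.coe_toNNReal hfin]
  set S : Set (ℝ × ℝ) := {p | p.1 - 1 ≤ p.2 ∧ p.2 ≤ p.1 + 1} with hS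
  have hSm : MeasurableSet S := by
    have h1 : Measurable fun p : ℝ × ℝ => p.1 - 1 := by fun_prop
    have h2 : Measurable fun p : ℝ × ℝ => p.1 + 1 := by fun_prop
    exact (measurableSet_le h1 measurable_snd).inter (measurableSet_le measurable_snd h2)
  have hind : Measurable (S.indicator fun p : ℝ × ℝ => ENNReal.ofReal (tiltedDensity a f p.1) *
      ENNReal.ofReal (K * (1 + (p.2 - u) ^ 2)⁻¹)) :=
    (by fun_prop : Measurable _).indicator hSm
  have hstep : ∀ x, ENNReal.ofReal (tiltedDensity a f x *
      Real.exp (-(x - u) ^ 2 / (2 * a) + 2 * |x - u|)) ≤ ∫⁻ t, S.indicator (fun p : ℝ × ℝ =>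
        ENNReal.ofReal (tiltedDensity a f p.1) * ENNReal.ofReal (K * (1 + (p.2 - u) ^ 2)⁻¹))
        (x, t) := by
    intro x
    rw [ENNReal.ofReal_mul (tiltedDensity_nonneg a hf0 x)]
    set A := ENNReal.ofReal (tiltedDensity a f x) *
      ENNReal.ofReal (Real.exp (-(x - u) ^ 2 / (2 * a) + 2 * |x - u|)) with hA
    calc A ≤ A * volume (Set.Icc (x - 1) (x + 1)) := by
          refine le_mul_of_one_le_right' ?_
          rw [Real.volume_Icc, ← ENNReal.ofReal_one]
          exact ENNReal.ofReal_le_ofReal (by linarith)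
      _ = ∫⁻ t, (Set.Icc (x - 1) (x + 1)).indicator (fun _ => A) t := by
          rw [lintegral_indicator_const measurableSet_Icc]
      _ ≤ _ := by
          refine lintegral_mono fun t => ?_
          by_cases ht : t ∈ Set.Icc (x - 1) (x + 1)
          · have ht' : (x, t) ∈ S := ht
            rw [Set.indicator_of_mem ht, Set.indicator_of_mem ht', hA]
            refine mul_le_mul_right (ENNReal.ofReal_le_ofReal (hker _ _ ?_)) _
            rw [abs_le]
            constructor <;> linarith [ht.1, ht.2]
          · rw [Set.indicator_of_notMem ht]
            exact zero_le
  calc _ ≤ _ := lintegral_mono hstep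
    _ = ∫⁻ t, ∫⁻ x, S.indicator (fun p : ℝ × ℝ =>
        ENNReal.ofReal (tiltedDensity a f p.1) * ENNReal.ofReal (K * (1 + (p.2 - u) ^ 2)⁻¹))
        (x, t) := lintegral_lintegral_swap hind.aemeasurable
    _ ≤ ∫⁻ t : ℝ, ENNReal.ofReal (K * (1 + (t - u) ^ 2)⁻¹) * ENNReal.ofReal C := by
        refine lintegral_mono fun t => ?_
        calc _ = ∫⁻ x in Set.Icc (t - 1) (t + 1), ENNReal.ofReal (K * (1 + (t - u) ^ 2)⁻¹) *
              ENNReal.ofReal (tiltedDensity a f x) := by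
              rw [← lintegral_indicator measurableSet_Icc]
              refine lintegral_congr fun x => ?_
              by_cases hx : x ∈ Set.Icc (t - 1) (t + 1)
              · have hx' : (x, t) ∈ S := ⟨by linarith [hx.2], by linarith [hx.1]⟩
                rw [Set.indicator_of_mem hx, Set.indicator_of_mem hx', mul_comm]
              · have hx' : (x, t) ∉ S := fun h => hx ⟨by linarith [h.2], by linarith [h.1]⟩
                rw [Set.indicator_of_notMem hx, Set.indicator_of_notMem hx']
          _ = ENNReal.ofReal (K * (1 + (t - u) ^ 2)⁻¹) * ∫⁻ x in Set.Icc (t - 1) (t + 1),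
              ENNReal.ofReal (tiltedDensity a f x) := lintegral_const_mul _ (by fun_prop)
          _ ≤ _ := mul_le_mul_right (hloc t) _
    _ = _ := by
        rw [lintegral_mul_const _ (by fun_prop),
          lintegral_sub_right_eq_self (fun t : ℝ => ENNReal.ofReal (K * (1 + t ^ 2)⁻¹))]

theorem abs_exp_sub_one_le_mul_exp (r : ℝ) : |Real.exp r - 1| ≤ |r| * Real.exp |r| := by
  rcases le_total 0 r with h | h
  · have h1 := Real.add_one_le_exp (-r)
    have h2 : Real.exp (-r) * Real.exp r = 1 := by rw [← Real.exp_add]; simp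
    rw [abs_of_nonneg h, abs_of_nonneg (by linarith [Real.one_le_exp h])]
    nlinarith [Real.exp_pos r]
  · have h1 := Real.add_one_le_exp r
    rw [abs_of_nonpos h, abs_of_nonpos (by linarith [Real.exp_le_one_iff.2 h])]
    nlinarith [Real.one_le_exp (neg_nonneg.2 h)]

/-- Moving the argument of the damping factor from `u` to `x` costs little. -/
theorem abs_exp_neg_mul_abs_sub_le {δ : ℝ} (h0 : 0 ≤ δ) (h1 : δ ≤ 1) (x u : ℝ) :
    |Real.exp (-(δ * |x|)) - Real.exp (-(δ * |u|))|
      ≤ δ * Real.exp (2 * |x - u|) * Real.exp (-(δ * |u|)) := by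
  set r := δ * |u| - δ * |x| with hr
  have hr1 : |r| ≤ δ * |x - u| := by
    rw [hr, ← mul_sub, abs_mul, abs_of_nonneg h0, abs_sub_comm]
    exact mul_le_mul_of_nonneg_left (abs_abs_sub_abs_le x u) h0
  have hr2 : |r| ≤ |x - u| := hr1.trans (mul_le_of_le_one_left (abs_nonneg _) h1)
  have e : Real.exp (-(δ * |x|)) - Real.exp (-(δ * |u|))
      = (Real.exp r - 1) * Real.exp (-(δ * |u|)) := by
    rw [sub_mul, ← Real.exp_add, one_mul]
    congr 2
    rw [hr]
    ring
  rw [e, abs_mul, Real.abs_exp]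
  refine mul_le_mul_of_nonneg_right ((abs_exp_sub_one_le_mul_exp r).trans ?_) (Real.exp_pos _).le
  have h3 : |x - u| ≤ Real.exp |x - u| := by linarith [Real.add_one_le_exp |x - u|]
  calc |r| * Real.exp |r| ≤ δ * |x - u| * Real.exp |x - u| := by gcongr
    _ ≤ δ * Real.exp |x - u| * Real.exp |x - u| := by gcongr
    _ = _ := by
      rw [mul_assoc, ← Real.exp_add]
      congr 2
      ring

theorem exp_neg_mul_abs_le {δ : ℝ} (h0 : 0 ≤ δ) (h1 : δ ≤ 1) (x u : ℝ) :
    Real.exp (-(δ * |x|)) ≤ Real.exp (2 * |x - u|) * Real.exp (-(δ * |u|)) := by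
  rw [← Real.exp_add, Real.exp_le_exp]
  have h2 : |u| - |x| ≤ |x - u| := by
    rw [abs_sub_comm]
    exact abs_sub_abs_le_abs_sub u x
  have h3 : δ * (|u| - |x|) ≤ δ * |x - u| := mul_le_mul_of_nonneg_left h2 h0
  have h4 : δ * |x - u| ≤ |x - u| := mul_le_of_le_one_left (abs_nonneg _) h1
  linarith [abs_nonneg (x - u)]

theorem integrable_exp_neg_mul_abs {c : ℝ} (hc : 0 < c) :
    Integrable fun y : ℝ => Real.exp (-(c * |y|)) := by
  have h : IntegrableOn (fun y : ℝ => Real.exp (-(c * |y|))) (Set.Ioi 0) := by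
    refine (integrableOn_exp_mul_Ioi (neg_lt_zero.2 hc) 0).congr_fun (fun y hy => ?_)
      measurableSet_Ioi
    simp only
    rw [abs_of_pos hy, neg_mul]
  have h' : IntegrableOn (fun y : ℝ => Real.exp (-(c * |y|))) (Set.Iic 0) := by
    refine (integrableOn_exp_mul_Iic hc 0).congr_fun (fun y hy => ?_) measurableSet_Iic
    simp only
    rw [abs_of_nonpos hy, mul_neg, neg_neg]
  rw [← integrableOn_univ, ← Set.Iic_union_Ioi (a := (0 : ℝ))]
  exact h'.union h

/-- Riemann–Lebesgue decay makes the damped averages of `h` vanish in the limit. -/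
theorem tendsto_mul_integral_norm_mul_exp {c H : ℝ} (hc : 0 < c) {h : ℝ → ℂ} (hcont : Continuous h)
    (hH : ∀ y, ‖h y‖ ≤ H) (h0 : Tendsto h (cocompact ℝ) (nhds 0)) :
    Tendsto (fun n : ℕ => (1 / ((n : ℝ) + 1)) *
      ∫ y, ‖h y‖ * Real.exp (-(1 / ((n : ℝ) + 1) * |c * y|))) atTop (nhds 0) := by
  have e : ∀ n : ℕ, (1 / ((n : ℝ) + 1)) *
      ∫ y, ‖h y‖ * Real.exp (-(1 / ((n : ℝ) + 1) * |c * y|))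
      = ∫ v, ‖h (((n : ℝ) + 1) * v)‖ * Real.exp (-(c * |v|)) := by
    intro n
    have hn : (0 : ℝ) < (n : ℝ) + 1 := by positivity
    have := Measure.integral_comp_mul_left
      (fun y : ℝ => ‖h y‖ * Real.exp (-(1 / ((n : ℝ) + 1) * |c * y|))) ((n : ℝ) + 1)
    rw [abs_of_pos (inv_pos.2 hn), smul_eq_mul, ← one_div] at this
    rw [← this]
    congr 1
    ext v
    congr 3
    rw [abs_mul, abs_mul, abs_of_pos hc, abs_of_pos hn]
    field_simp
  simp_rw [e]
  have hlim : ∀ᵐ v : ℝ, Tendsto (fun n : ℕ => ‖h (((n : ℝ) + 1) * v)‖ * Real.exp (-(c * |v|)))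
      atTop (nhds 0) := by
    filter_upwards [Measure.ae_ne volume (0 : ℝ)] with v hv
    have h1 : Tendsto (fun n : ℕ => ((n : ℝ) + 1) * v) atTop (cocompact ℝ) := by
      refine (Homeomorph.mulRight₀ v hv).isClosedEmbedding.tendsto_cocompact.comp ?_
      exact (tendsto_atTop_add_const_right _ 1 tendsto_natCast_atTop_atTop).mono_right
        atTop_le_cocompact
    simpa using ((h0.comp h1).norm).mul_const (Real.exp (-(c * |v|)))
  have := tendsto_integral_of_dominated_convergence (fun v : ℝ => H * Real.exp (-(c * |v|)))
    (fun n => (by fun_prop : Continuous fun v : ℝ =>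
      ‖h (((n : ℝ) + 1) * v)‖ * Real.exp (-(c * |v|))).aestronglyMeasurable)
    ((integrable_exp_neg_mul_abs hc).const_mul H) (fun n => Eventually.of_forall fun v => ?_) hlim
  · simpa using this
  · rw [norm_mul, norm_norm, Real.norm_eq_abs, Real.abs_exp]
    exact mul_le_mul_of_nonneg_right (hH _) (Real.exp_pos _).le

/-- The duality `∫ F (k ∗ h) = ∫ (F ∗ k) h`. The tilted density `F` need not be integrable, so Fubini's
theorem does not apply directly: the two sides are damped by `exp (-δ |x|)` and `exp (-δ |a y|)`
respectively, and their difference vanishes as `δ → 0` because `h` vanishes at infinity. -/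
theorem integral_tiltedDensity_mul_eq {a : ℝ} (ha0 : 0 < a) {f : ℝ → ℝ}
    (hf : Measurable f) (hf0 : ∀ x, 0 ≤ f x) {D : ℝ≥0}
    (hD : ∀ u : ℝ, ∫⁻ x, ENNReal.ofReal (tiltedDensity a f x *
      Real.exp (-(x - u) ^ 2 / (2 * a) + 2 * |x - u|)) ≤ D)
    (hgi : Integrable (oddTransform a f)) {h : ℝ → ℂ} (hcont : Continuous h) {H : ℝ}
    (hH : ∀ y, ‖h y‖ ≤ H) (h0 : Tendsto h (cocompact ℝ) (nhds 0)) {l : ℝ → ℂ}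
    (hl : ∀ x, ∫ y : ℝ, (oddKernel a (x - a * y) : ℂ) * h y = l x)
    (hFl : Integrable fun x => (tiltedDensity a f x : ℂ) * l x) :
    ∫ x, (tiltedDensity a f x : ℂ) * l x = ∫ y, (oddTransform a f y : ℂ) * h y := by
  have hFm := measurable_tiltedDensity a hf
  have hkm := measurable_oddKernel a
  have hhm := hcont.measurable
  set δ : ℕ → ℝ := fun n => 1 / ((n : ℝ) + 1) with hδ
  have hδ0 : ∀ n, 0 < δ n := fun n => by positivity
  have hδ1 : ∀ n, δ n ≤ 1 := fun n => by
    rw [hδ]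
    exact div_le_one_of_le₀ (by have : (0 : ℝ) ≤ n := n.cast_nonneg; linarith) (by positivity)
  have hδlim : ∀ t : ℝ, Tendsto (fun n => ((Real.exp (-(δ n * t)) : ℝ) : ℂ)) atTop (nhds 1) := by
    intro t
    have h1 : Tendsto δ atTop (nhds 0) := tendsto_one_div_add_atTop_nhds_zero_nat
    have h2 : Tendsto (fun n => Real.exp (-(δ n * t))) atTop (nhds 1) := by
      have := (Real.continuous_exp.tendsto _).comp (h1.mul_const t).neg
      simpa [Function.comp_def] using this
    exact_mod_cast (Complex.continuous_ofReal.tendsto 1).comp h2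
  set Φ : ℝ × ℝ → ℝ := fun p => tiltedDensity a f p.1 *
      Real.exp (-(p.1 - a * p.2) ^ 2 / (2 * a) + 2 * |p.1 - a * p.2|) with hΦ
  have hΦ0 : ∀ p, 0 ≤ Φ p := fun p =>
    mul_nonneg (tiltedDensity_nonneg a hf0 _) (Real.exp_pos _).le
  have hΦm : Measurable Φ := by fun_prop
  -- a weight in `y` times `Φ` is integrable on the plane, with the expected bound
  have hw : ∀ w : ℝ → ℝ, Measurable w → (∀ y, 0 ≤ w y) → Integrable w →
      Integrable (fun p : ℝ × ℝ => Φ p * w p.2) (volume.prod volume) ∧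
        ∫ p : ℝ × ℝ, Φ p * w p.2 ∂(volume.prod volume) ≤ D * ∫ y, w y := by
    intro w hwm hw0 hwi
    have hm : Measurable fun p : ℝ × ℝ => Φ p * w p.2 := by fun_prop
    have hle : ∫⁻ p : ℝ × ℝ, ENNReal.ofReal (Φ p * w p.2) ∂(volume.prod volume)
        ≤ ENNReal.ofReal (D * ∫ y, w y) := by
      rw [lintegral_prod_symm _ (by fun_prop)]
      calc _ = ∫⁻ y, (∫⁻ x, ENNReal.ofReal (Φ (x, y))) * ENNReal.ofReal (w y) := by
            refine lintegral_congr fun y => ?_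
            rw [← lintegral_mul_const _ (by fun_prop)]
            exact lintegral_congr fun x => ENNReal.ofReal_mul (hΦ0 _)
        _ ≤ ∫⁻ y, D * ENNReal.ofReal (w y) :=
            lintegral_mono fun y => mul_le_mul_left (hD (a * y)) _
        _ = _ := by
            rw [lintegral_const_mul _ (by fun_prop), ENNReal.ofReal_mul D.coe_nonneg,
              ofReal_integral_eq_lintegral_ofReal hwi (Eventually.of_forall hw0),
              ENNReal.ofReal_coe_nnreal]
    have hnn : 0 ≤ᵐ[volume.prod volume] fun p : ℝ × ℝ => Φ p * w p.2 :=
      Eventually.of_forall fun p => mul_nonneg (hΦ0 p) (hw0 _)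
    have hi : Integrable (fun p : ℝ × ℝ => Φ p * w p.2) (volume.prod volume) := by
      refine ⟨hm.aestronglyMeasurable, ?_⟩
      rw [hasFiniteIntegral_iff_ofReal hnn]
      exact hle.trans_lt ENNReal.ofReal_lt_top
    refine ⟨hi, ?_⟩
    rw [← ofReal_integral_eq_lintegral_ofReal hi hnn] at hle
    exact (ENNReal.ofReal_le_ofReal_iff (mul_nonneg D.coe_nonneg (integral_nonneg hw0))).1 hle
  have hexp : ∀ n, Integrable fun y : ℝ => Real.exp (-(δ n * |a * y|)) := by
    intro n
    refine (integrable_exp_neg_mul_abs (mul_pos (hδ0 n) ha0)).congr (Eventually.of_forall fun y => ?_)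
    simp only [abs_mul, abs_of_pos ha0, mul_assoc]
  have hT : ∀ p : ℝ × ℝ, ‖(tiltedDensity a f p.1 : ℂ) * (oddKernel a (p.1 - a * p.2) : ℂ) * h p.2‖
      * Real.exp (2 * |p.1 - a * p.2|) ≤ Φ p * ‖h p.2‖ := by
    intro p
    rw [norm_mul, norm_mul, Complex.norm_real, Complex.norm_real, Real.norm_eq_abs,
      Real.norm_eq_abs, abs_of_nonneg (tiltedDensity_nonneg a hf0 _), hΦ]
    simp only
    rw [Real.exp_add]
    have := mul_le_mul_of_nonneg_left (abs_oddKernel_le a (p.1 - a * p.2))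
      (mul_nonneg (tiltedDensity_nonneg a hf0 p.1) (mul_nonneg (norm_nonneg (h p.2))
        (Real.exp_pos (2 * |p.1 - a * p.2|)).le))
    linarith
  set T : ℝ × ℝ → ℂ := fun p =>
    (tiltedDensity a f p.1 : ℂ) * (oddKernel a (p.1 - a * p.2) : ℂ) * h p.2 with hTdef
  have hTm : Measurable T := by fun_prop
  have hHn : 0 ≤ H := (norm_nonneg _).trans (hH 0)
  have hdom : ∀ n, Integrable (fun p : ℝ × ℝ => Φ p * (H * Real.exp (-(δ n * |a * p.2|))))
      (volume.prod volume) := fun n =>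
    (hw (fun y => H * Real.exp (-(δ n * |a * y|))) (by fun_prop) (fun y => by positivity)
      ((hexp n).const_mul H)).1
  have hTH : ∀ n p, (‖T p‖ * Real.exp (2 * |p.1 - a * p.2|)) * Real.exp (-(δ n * |a * p.2|))
      ≤ Φ p * (H * Real.exp (-(δ n * |a * p.2|))) := by
    intro n p
    rw [← mul_assoc]
    exact mul_le_mul_of_nonneg_right
      ((hT p).trans (mul_le_mul_of_nonneg_left (hH _) (hΦ0 p))) (Real.exp_pos _).le
  have hA : ∀ n, Integrable (fun p : ℝ × ℝ => T p * (Real.exp (-(δ n * |p.1|)) : ℝ))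
      (volume.prod volume) := by
    intro n
    refine (hdom n).mono' (by fun_prop : Measurable _).aestronglyMeasurable
      (Eventually.of_forall fun p => ?_)
    rw [norm_mul, Complex.norm_real, Real.norm_eq_abs, Real.abs_exp]
    calc ‖T p‖ * Real.exp (-(δ n * |p.1|))
        ≤ ‖T p‖ * (Real.exp (2 * |p.1 - a * p.2|) * Real.exp (-(δ n * |a * p.2|))) :=
          mul_le_mul_of_nonneg_left (exp_neg_mul_abs_le (hδ0 n).le (hδ1 n) _ _) (norm_nonneg _)
      _ = (‖T p‖ * Real.exp (2 * |p.1 - a * p.2|)) * Real.exp (-(δ n * |a * p.2|)) := by ring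
      _ ≤ _ := hTH n p
  have hB : ∀ n, Integrable (fun p : ℝ × ℝ => T p * (Real.exp (-(δ n * |a * p.2|)) : ℝ))
      (volume.prod volume) := by
    intro n
    refine (hdom n).mono' (by fun_prop : Measurable _).aestronglyMeasurable
      (Eventually.of_forall fun p => ?_)
    rw [norm_mul, Complex.norm_real, Real.norm_eq_abs, Real.abs_exp]
    calc ‖T p‖ * Real.exp (-(δ n * |a * p.2|))
        ≤ (‖T p‖ * Real.exp (2 * |p.1 - a * p.2|)) * Real.exp (-(δ n * |a * p.2|)) := by
          gcongr
          exact le_mul_of_one_le_right (norm_nonneg _) (Real.one_le_exp (by positivity))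
      _ ≤ _ := hTH n p
  have hdiff : ∀ n, ‖(∫ p, T p * (Real.exp (-(δ n * |p.1|)) : ℝ) ∂(volume.prod volume))
      - ∫ p, T p * (Real.exp (-(δ n * |a * p.2|)) : ℝ) ∂(volume.prod volume)‖
      ≤ D * (δ n * ∫ y, ‖h y‖ * Real.exp (-(δ n * |a * y|))) := by
    intro n
    have hwi : Integrable fun y => δ n * (‖h y‖ * Real.exp (-(δ n * |a * y|))) := by
      refine Integrable.const_mul ?_ _
      refine ((hexp n).const_mul H).mono' (by fun_prop : Measurable _).aestronglyMeasurable
        (Eventually.of_forall fun y => ?_)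
      rw [norm_mul, norm_norm, Real.norm_eq_abs, Real.abs_exp]
      exact mul_le_mul_of_nonneg_right (hH y) (Real.exp_pos _).le
    obtain ⟨hi, hb⟩ := hw (fun y => δ n * (‖h y‖ * Real.exp (-(δ n * |a * y|)))) (by fun_prop)
      (fun y => by have := hδ0 n; positivity) hwi
    rw [integral_const_mul] at hb
    rw [← integral_sub (hA n) (hB n)]
    refine (norm_integral_le_of_norm_le hi (Eventually.of_forall fun p => ?_)).trans hb
    rw [← mul_sub, norm_mul, ← Complex.ofReal_sub, Complex.norm_real, Real.norm_eq_abs]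
    calc ‖T p‖ * |Real.exp (-(δ n * |p.1|)) - Real.exp (-(δ n * |a * p.2|))|
        ≤ ‖T p‖ * (δ n * Real.exp (2 * |p.1 - a * p.2|) * Real.exp (-(δ n * |a * p.2|))) :=
          mul_le_mul_of_nonneg_left (abs_exp_neg_mul_abs_sub_le (hδ0 n).le (hδ1 n) _ _)
            (norm_nonneg _)
      _ = (‖T p‖ * Real.exp (2 * |p.1 - a * p.2|)) * (δ n * Real.exp (-(δ n * |a * p.2|))) := by
          ring
      _ ≤ (Φ p * ‖h p.2‖) * (δ n * Real.exp (-(δ n * |a * p.2|))) :=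
          mul_le_mul_of_nonneg_right (hT p) (mul_nonneg (hδ0 n).le (Real.exp_pos _).le)
      _ = _ := by ring
  have hAval : ∀ n, ∫ p, T p * (Real.exp (-(δ n * |p.1|)) : ℝ) ∂(volume.prod volume)
      = ∫ x, (tiltedDensity a f x : ℂ) * l x * (Real.exp (-(δ n * |x|)) : ℝ) := by
    intro n
    rw [integral_prod _ (hA n)]
    congr 1
    ext x
    dsimp only
    rw [integral_mul_const, ← hl x, ← integral_const_mul]
    simp only [hTdef, mul_assoc]
  have hBval : ∀ n, ∫ p, T p * (Real.exp (-(δ n * |a * p.2|)) : ℝ) ∂(volume.prod volume)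
      = ∫ y, (oddTransform a f y : ℂ) * h y * (Real.exp (-(δ n * |a * y|)) : ℝ) := by
    intro n
    rw [integral_prod_symm _ (hB n)]
    congr 1
    ext y
    dsimp only
    rw [integral_mul_const, oddTransform, ← integral_complex_ofReal]
    simp only [hTdef, Complex.ofReal_mul]
    rw [integral_mul_const]
  have hdamp : ∀ (u : ℝ → ℂ) (t : ℝ → ℝ), Measurable t → (∀ x, 0 ≤ t x) → Integrable u →
      Tendsto (fun n => ∫ x, u x * (Real.exp (-(δ n * t x)) : ℝ)) atTop (nhds (∫ x, u x)) := by
    intro u t htm ht hu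
    refine tendsto_integral_of_dominated_convergence (fun x => ‖u x‖) (fun n => ?_) hu.norm
      (fun n => Eventually.of_forall fun x => ?_) (Eventually.of_forall fun x => ?_)
    · exact hu.aestronglyMeasurable.mul (by fun_prop : Measurable _).aestronglyMeasurable
    · rw [norm_mul, Complex.norm_real, Real.norm_eq_abs, Real.abs_exp]
      exact mul_le_of_le_one_right (norm_nonneg _) (Real.exp_le_one_iff.2
        (neg_nonpos.2 (mul_nonneg (hδ0 n).le (ht x))))
    · simpa using (hδlim (t x)).const_mul (u x)
  have hgh : Integrable fun y => (oddTransform a f y : ℂ) * h y :=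
    hgi.ofReal.mul_bdd (c := H) hcont.aestronglyMeasurable (Eventually.of_forall hH)
  have l1 := hdamp _ (fun x => |x|) (by fun_prop) (fun x => abs_nonneg x) hFl
  have l2 := hdamp _ (fun y => |a * y|) (by fun_prop) (fun y => abs_nonneg _) hgh
  have l3 := (tendsto_mul_integral_norm_mul_exp ha0 hcont hH h0).const_mul (D : ℝ)
  rw [mul_zero] at l3
  have l4 := squeeze_zero_norm hdiff l3
  simp_rw [hAval, hBval] at l4
  exact sub_eq_zero.1 (tendsto_nhds_unique (l1.sub l2) l4)

/-! ### Bounds on the Hermite coefficients -/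

theorem integrable_sq_of_le {f : ℝ → ℝ} (hf0 : ∀ x, 0 ≤ f x) (hfi : Integrable f) {M : ℝ}
    (hM : ∀ x, f x ≤ M) : Integrable fun x => f x ^ 2 := by
  refine (hfi.const_mul M).mono' (hfi.aestronglyMeasurable.pow 2) (Eventually.of_forall fun x => ?_)
  rw [Real.norm_eq_abs, abs_of_nonneg (sq_nonneg _), sq]
  exact mul_le_mul_of_nonneg_right (hM x) (hf0 x)

theorem integrable_mul_hermiteFun {a : ℝ} (ha0 : 0 < a) (ha1 : a < 1) {f : ℝ → ℝ}
    (hf0 : ∀ x, 0 ≤ f x) (hfi : Integrable f) {M : ℝ} (hM : ∀ x, f x ≤ M) (n : ℕ) :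
    Integrable fun x => f x * hermiteFun a n x := by
  refine ((integrable_sq_of_le hf0 hfi hM).add (integrable_hermiteFun_sq ha0 ha1 n)).mono'
    (hfi.aestronglyMeasurable.mul (continuous_hermiteFun a n).aestronglyMeasurable)
    (Eventually.of_forall fun x => ?_)
  rw [Pi.add_apply, Real.norm_eq_abs, abs_le]
  constructor <;> nlinarith [sq_nonneg (f x + hermiteFun a n x), sq_nonneg (f x - hermiteFun a n x),
    sq_nonneg (f x), sq_nonneg (hermiteFun a n x)]

theorem abs_integral_mul_hermiteFun_le {a : ℝ} (ha0 : 0 < a) (ha1 : a < 1) {f : ℝ → ℝ}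
    (hf0 : ∀ x, 0 ≤ f x) (hfi : Integrable f) (hf1 : ∫ x, f x = 1) {M : ℝ} (hM : ∀ x, f x ≤ M)
    (n : ℕ) : |∫ x, f x * hermiteFun a n x| ≤ (M + 1) / 2 := by
  have hf2 := integrable_sq_of_le hf0 hfi hM
  have hH2 := integrable_hermiteFun_sq ha0 ha1 n
  have h1 : ∫ x, f x ^ 2 ≤ M := by
    calc ∫ x, f x ^ 2 ≤ ∫ x, M * f x := integral_mono hf2 (hfi.const_mul M) fun x => by
          rw [sq]
          exact mul_le_mul_of_nonneg_right (hM x) (hf0 x)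
      _ = M := by rw [integral_const_mul, hf1, mul_one]
  calc |∫ x, f x * hermiteFun a n x| ≤ ∫ x, |f x * hermiteFun a n x| := abs_integral_le_integral_abs
    _ ≤ ∫ x, (f x ^ 2 + hermiteFun a n x ^ 2) / 2 := by
        refine integral_mono (integrable_mul_hermiteFun ha0 ha1 hf0 hfi hM n).norm
          ((hf2.add hH2).div_const 2) fun x => ?_
        rw [abs_le]
        constructor <;>
          nlinarith [sq_nonneg (f x + hermiteFun a n x), sq_nonneg (f x - hermiteFun a n x)]
    _ = ((∫ x, f x ^ 2) + 1) / 2 := by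
        rw [integral_div, integral_add hf2 hH2, integral_hermiteFun_sq ha0 ha1]
    _ ≤ _ := by linarith

/-- The Hermite coefficients are bounded by the `L¹` norm of the odd transform, tested against the
solution of the convolution equation. -/
theorem abs_integral_mul_hermiteFun_le_of_lintegral_le {a : ℝ} (ha0 : 0 < a) (ha1 : a < 1)
    {f : ℝ → ℝ} (hf : Measurable f) (hf0 : ∀ x, 0 ≤ f x) (hfi : Integrable f) {M : ℝ}
    (hM : ∀ x, f x ≤ M) {C E : ℝ} (hE : 0 ≤ E)
    (hloc : ∀ t : ℝ, ∫⁻ x in Set.Icc (t - 1) (t + 1), ENNReal.ofReal (tiltedDensity a f x)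
      ≤ ENNReal.ofReal C)
    (hg : ∫⁻ y, ‖oddTransform a f y‖ₑ ≤ ENNReal.ofReal E) {n : ℕ} {h : ℝ → ℂ} {H : ℝ}
    (hcont : Continuous h) (hH : ∀ y, ‖h y‖ ≤ H) (h0 : Tendsto h (cocompact ℝ) (nhds 0))
    (hl : ∀ x, ∫ y : ℝ, (oddKernel a (x - a * y) : ℂ) * h y
        = ((Real.exp (-(x ^ 2 / (2 * hermiteVar a))) * hermiteFun a n x : ℝ) : ℂ)) :
    |∫ x, f x * hermiteFun a n x| ≤ H * E := by
  obtain ⟨D, hD⟩ := exists_lintegral_tiltedDensity_mul_le ha0 hf hf0 hloc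
  have hgi : Integrable (oddTransform a f) :=
    ⟨(stronglyMeasurable_oddTransform a hf).aestronglyMeasurable,
      lt_of_le_of_lt hg ENNReal.ofReal_lt_top⟩
  have e : ∀ x, (tiltedDensity a f x : ℂ) *
      ((Real.exp (-(x ^ 2 / (2 * hermiteVar a))) * hermiteFun a n x : ℝ) : ℂ)
      = ((f x * hermiteFun a n x : ℝ) : ℂ) := by
    intro x
    rw [← Complex.ofReal_mul, tiltedDensity, Real.exp_neg]
    congr 1
    have := (Real.exp_pos (x ^ 2 / (2 * hermiteVar a))).ne'
    field_simp
  have key := integral_tiltedDensity_mul_eq ha0 hf hf0 hD hgi hcont hH h0 hl (by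
    simp_rw [e]
    exact (integrable_mul_hermiteFun ha0 ha1 hf0 hfi hM n).ofReal)
  simp_rw [e] at key
  rw [integral_complex_ofReal] at key
  rw [← Real.norm_eq_abs, ← Complex.norm_real, key]
  have hHn : 0 ≤ H := (norm_nonneg _).trans (hH 0)
  have hnorm : ∫ y, ‖oddTransform a f y‖ ≤ E := by
    rw [← ofReal_integral_norm_eq_lintegral_enorm hgi] at hg
    exact (ENNReal.ofReal_le_ofReal_iff hE).1 hg
  calc ‖∫ y, (oddTransform a f y : ℂ) * h y‖ ≤ ∫ y, H * ‖oddTransform a f y‖ := by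
        refine norm_integral_le_of_norm_le (hgi.norm.const_mul H) (Eventually.of_forall fun y => ?_)
        rw [norm_mul, Complex.norm_real, mul_comm]
        exact mul_le_mul_of_nonneg_right (hH y) (norm_nonneg _)
    _ = H * ∫ y, ‖oddTransform a f y‖ := integral_const_mul _ _
    _ ≤ _ := mul_le_mul_of_nonneg_left hnorm hHn

/-- When `a ε ≤ 2` the bound `|a y - ψ y| ≤ a ε` puts every median in the window of half-width
`√(2 a ε)`, so that the odd transform is integrable with a norm controlled by `M` and `B`. This
bounds the local mass of the tilted density, and Tonelli's theorem then improves the norm of the odd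
transform to `O(ε)`. -/
theorem lintegral_oddTransform_le_of_integral_le {a : ℝ} (ha0 : 0 < a) (ha1 : a < 1) {f : ℝ → ℝ}
    (hf : Measurable f) (hf0 : ∀ x, 0 ≤ f x) (hfi : Integrable f) (hf1 : ∫ x, f x = 1) {M B : ℝ}
    (hM : ∀ x, f x ≤ M) {ψ : ℝ → ℝ} (hψ : StrictMono ψ)
    (hbal : ∀ y, ∫ x, posteriorWeight f y x * Real.sign (x - ψ y) = 0) {ε : ℝ} (hε : 0 ≤ ε)
    (haε : a * ε ≤ 2)
    (hBi : Integrable (fun y : ℝ =>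
      Real.exp ((1 - a) / 2 * y ^ 2 - sInf ((fun x : ℝ => (x - y) ^ 2 / 2) ''
        Set.Icc (a * y - √(2 * a * ε)) (a * y + √(2 * a * ε)))) * |a * y - ψ y|))
    (hB : ∫ y : ℝ,
      Real.exp ((1 - a) / 2 * y ^ 2 - sInf ((fun x : ℝ => (x - y) ^ 2 / 2) ''
        Set.Icc (a * y - √(2 * a * ε)) (a * y + √(2 * a * ε)))) * |a * y - ψ y| ≤ B)
    {b : ℤ → ℝ} (hbs : Summable b) (hbε : ∑' i, b i ≤ ε)
    (hb : ∀ x : ℝ, |monoInverse ψ x - x / a| ≤ b ⌊x⌋) :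
    (∀ t : ℝ, ∫⁻ x in Set.Icc (t - 1) (t + 1), ENNReal.ofReal (tiltedDensity a f x)
      ≤ ENNReal.ofReal (((∫ t : ℝ, Real.exp (-t ^ 2 / (2 * a))) + a * (2 * M * B))
        / oddKernelTail a 1)) ∧
    ∫⁻ y, ‖oddTransform a f y‖ₑ ≤ 2 * (ENNReal.ofReal ε *
      ENNReal.ofReal (((∫ t : ℝ, Real.exp (-t ^ 2 / (2 * a))) + a * (2 * M * B))
        / oddKernelTail a 1)) := by
  have hM0 : 0 ≤ M := (hf0 0).trans (hM 0)
  have hb0 : ∀ i, 0 ≤ b i := fun i => by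
    have := (abs_nonneg _).trans (hb i)
    rwa [Int.floor_intCast] at this
  have hdist : ∀ y, |a * y - ψ y| ≤ √(2 * a * ε) := by
    intro y
    have h1 := (hb (ψ y)).trans ((hbs.le_tsum _ fun j _ => hb0 j).trans hbε)
    rw [monoInverse_apply hψ] at h1
    have h2 : |a * y - ψ y| ≤ a * ε := by
      have e : a * y - ψ y = a * (y - ψ y / a) := by field_simp
      rw [e, abs_mul, abs_of_pos ha0]
      exact mul_le_mul_of_nonneg_left h1 ha0.le
    refine h2.trans (Real.le_sqrt_of_sq_le ?_)
    nlinarith [mul_nonneg ha0.le hε]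
  have hpt : ∀ y, |oddTransform a f y| ≤ 2 * M * (Real.exp ((1 - a) / 2 * y ^ 2 -
      sInf ((fun x : ℝ => (x - y) ^ 2 / 2) ''
        Set.Icc (a * y - √(2 * a * ε)) (a * y + √(2 * a * ε)))) * |a * y - ψ y|) := fun y =>
    abs_oddTransform_le_of_mem_window ha0 ha1 hf0 hfi hM (hbal y) (hdist y)
  have hgi : Integrable (oddTransform a f) := (hBi.const_mul (2 * M)).mono'
    (stronglyMeasurable_oddTransform a hf).aestronglyMeasurable (Eventually.of_forall hpt)
  have hG : ∫ y, |oddTransform a f y| ≤ 2 * M * B := by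
    refine (integral_mono hgi.norm (hBi.const_mul (2 * M)) hpt).trans ?_
    rw [integral_const_mul]
    exact mul_le_mul_of_nonneg_left hB (by positivity)
  have hloc := lintegral_tiltedDensity_Icc_le ha0 ha1 hf hf0 hfi hf1 hgi hG
  exact ⟨hloc, lintegral_oddTransform_le ha0 ha1 hf hf0 hfi hψ hbal hbs hbε hb hloc⟩

theorem theorem2 (a : ℝ) (ha0 : 0 < a) (ha1 : a < 1) (M B : ℝ) :
    ∃ L : ℕ → ℝ, (L =O[atTop] fun n : ℕ => (n : ℝ) ^ (1 / 4 : ℝ)) ∧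
      ∀ {Ω : Type*} [MeasurableSpace Ω] (P : Measure Ω) [IsProbabilityMeasure P]
        (X Z : Ω → ℝ) (_ : Measurable X) (_ : Measurable Z)
        (_ : IndepFun X Z P) (_ : P.map Z = gaussianReal 0 1)
        -- `f` is a density of `X`, bounded by `M`
        (f : ℝ → ℝ) (_ : Measurable f) (_ : ∀ x, 0 ≤ f x)
        (_ : P.map X = volume.withDensity (fun x => ENNReal.ofReal (f x)))
        (_ : ∀ x, f x ≤ M)
        -- `ψ y` is a median of `X` given `X + Z = y`
        (ψ : ℝ → ℝ) (_ : ∀ y, IsMedian (gaussianPosterior (P.map X) y) (ψ y))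
        (ε : ℝ) (_ : 0 ≤ ε)
        (_ : Integrable (fun y : ℝ =>
            Real.exp ((1 - a) / 2 * y ^ 2 -
              sInf ((fun x : ℝ => (x - y) ^ 2 / 2) ''
                Set.Icc (a * y - √(2 * a * ε)) (a * y + √(2 * a * ε)))) * |a * y - ψ y|))
        (_ : ∫ y : ℝ,
            Real.exp ((1 - a) / 2 * y ^ 2 -
              sInf ((fun x : ℝ => (x - y) ^ 2 / 2) ''
                Set.Icc (a * y - √(2 * a * ε)) (a * y + √(2 * a * ε)))) * |a * y - ψ y| ≤ B)
        (b : ℤ → ℝ) (_ : Summable b) (_ : ∑' i, b i ≤ ε)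
        (_ : ∀ x : ℝ, |monoInverse ψ x - x / a| ≤ b ⌊x⌋),
        ∀ n : ℕ, 1 ≤ n → |∫ x : ℝ, f x * hermiteFun a n x| ≤ L n * ε := by
  obtain ⟨C₀, hC₀, hsol⟩ := exists_oddKernel_preimage_hermiteFun ha0 ha1
  set C : ℝ := ((∫ t : ℝ, Real.exp (-t ^ 2 / (2 * a))) + a * (2 * M * B)) / oddKernelTail a 1
    with hC
  refine ⟨fun n => (2 * C₀ * C + (M + 1) / 2 * (a / 2)) * (n : ℝ) ^ (1 / 4 : ℝ),
    (isBigO_refl _ _).const_mul_left _, ?_⟩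
  intro Ω _ P _ X Z hX _ _ _ f hf hf0 hden hM ψ hψ ε hε hBi hB b hbs hbε hb n hn
  have hprob : IsProbabilityMeasure (volume.withDensity fun x => ENNReal.ofReal (f x)) := by
    rw [← hden]
    exact Measure.isProbabilityMeasure_map hX.aemeasurable
  rw [hden] at hψ
  have hlint : ∫⁻ x, ENNReal.ofReal (f x) = 1 := by
    rw [← setLIntegral_univ, ← withDensity_apply _ MeasurableSet.univ, measure_univ]
  have hfi : Integrable f := by
    refine ⟨hf.aestronglyMeasurable, ?_⟩
    rw [hasFiniteIntegral_iff_ofReal (Eventually.of_forall hf0), hlint]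
    exact ENNReal.one_lt_top
  have hf1 : ∫ x, f x = 1 := by
    rw [integral_eq_lintegral_of_nonneg_ae (Eventually.of_forall hf0) hf.aestronglyMeasurable,
      hlint, ENNReal.toReal_one]
  have hM0 : 0 ≤ M := (hf0 0).trans (hM 0)
  have hB0 : 0 ≤ B := (integral_nonneg fun y => by positivity).trans hB
  have hC0 : 0 ≤ C := div_nonneg (add_nonneg (integral_nonneg fun t => (Real.exp_pos _).le)
    (by positivity)) (oddKernelTail_nonneg ha0 1)
  have hn1 : 1 ≤ (n : ℝ) ^ (1 / 4 : ℝ) :=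
    Real.one_le_rpow (by exact_mod_cast hn) (by norm_num)
  rcases le_or_gt (a * ε) 2 with haε | haε
  · obtain ⟨hloc, hg⟩ := lintegral_oddTransform_le_of_integral_le ha0 ha1 hf hf0 hfi hf1 hM
      (strictMono_of_isMedian hf hf0 hfi hψ)
      (fun y => integral_posteriorWeight_mul_sign hf hf0 hfi (hψ y)) hε haε hBi hB hbs hbε hb
    rw [← hC, ← ENNReal.ofReal_mul hε, ← ENNReal.ofReal_ofNat, ← ENNReal.ofReal_mul two_pos.le] at hg
    obtain ⟨h, hcont, hH, h0, hl⟩ := hsol n hn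
    refine (abs_integral_mul_hermiteFun_le_of_lintegral_le ha0 ha1 hf hf0 hfi hM (by positivity)
      hloc hg hcont hH h0 hl).trans ?_
    have : 0 ≤ (M + 1) / 2 * (a / 2) * (n : ℝ) ^ (1 / 4 : ℝ) * ε := by positivity
    linarith
  · -- here `ε` is bounded below and the unit norm of the Hermite functions suffices
    refine (abs_integral_mul_hermiteFun_le ha0 ha1 hf0 hfi hf1 hM n).trans ?_
    have h1 : (M + 1) / 2 ≤ (M + 1) / 2 * (a * ε / 2) * (n : ℝ) ^ (1 / 4 : ℝ) := by
      rw [mul_assoc]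
      refine le_mul_of_one_le_right (by positivity) ?_
      nlinarith
    have : 0 ≤ 2 * C₀ * C * (n : ℝ) ^ (1 / 4 : ℝ) * ε := by positivity
    linarith
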